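/- Work over the category $\mathrm{CGTop}$ of compactly generated Hausdorff spaces with the open cover topology; fibre products of spaces are formed in $\mathrm{CGTop}$. A topological groupoid $\mathcal{G}=[\mathcal{G}_1\rightrightarrows\mathcal{G}_0]$ is a groupoid internal to $\mathrm{CGTop}$. A principal $\mathcal{G}$-bundle over a space $M$ is a space $P$ with a right $\mathcal{G}$-action and a continuous map $\pi\colon P\to M$ admitting local sections such that $\pi(p\cdot\gamma)=\pi(p)$ and $P\times_{\mathcal{G}_0}\mathcal{G}_1\to P\times_M P$, $(p,\gamma)\mapsto(p,p\cdot\gamma)$, is a homeomorphism; $B\mathcal{G}$ denotes the stack over $\mathrm{CGTop}$ of principal $\mathcal{G}$-bundles. A topological stack is a stack over $\mathrm{CGTop}$ (a category fibred in groupoids with effective descent for open covers) that is equivalent over $\mathrm{CGTop}$ to $B\mathcal{G}$ for some topological groupoid $\mathcal{G}$; such a $\mathcal{G}$ is called a presentation of it. A morphism $\phi=(\phi_1,\phi_0)\colon\mathcal{G}\to\mathcal{H}$ of topological groupoids (a continuous functor) induces the morphism of stacks $B\mathcal{G}\to B\mathcal{H}$ that sends a principal $\mathcal{G}$-bundle $P$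 to $(P\times_{\mathcal{G}_0}(\mathcal{G}_0\times_{\phi_0,\mathcal{H}_0,t}\mathcal{H}_1))/\mathcal{G}_1$. A continuous map $p\colon E\to C$ is locally a Hurewicz (respectively, Serre) fibration if every $e\in E$ has an open neighbourhood $V\subseteq E$ and there is an open $W\subseteq C$ with $p(V)\subseteq W$ such that $p|_V\colon V\to W$ is a Hurewicz (respectively, Serre) fibration, that is, has the homotopy lifting property for all spaces (respectively, for all cubes $[0,1]^n$, $n\ge 0$). A topological stack is a Hurewicz (respectively, Serre) stack if it has a presentation $[R\rightrightarrows Y]$ whose source map $R\to Y$ is locally a Hurewicz (respectively, Serre) fibration. A morphism of stacks $F\colon\mathcal{D}\to\mathcal{C}$ is a Hurewicz (respectively, Serre) morphism if for every space $U$ and every morphism of stacks $\underline{U}\to\mathcal{C}$ from the stack represented by $U$, the $2$-fibre product $\mathcal{D}\times_{\mathcal{C}}\underline{U}$ is a Hurewicz (respectively, Serre) stack. Corollary. Let $X$ be a compactly generated Hausdorff space, let $\mathcal{H}$ be a topological groupoid in $\mathrm{CGTop}$, and let $[X\rightrightarrows X]\to\mathcal{H}$ be a morphism of topological groupoids, where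 $[X\rightrightarrows X]$ is the groupoid on $X$ with only identity arrows. Then the induced morphism of stacks $B[X\rightrightarrows X]\to B\mathcal{H}$ is both a Serre morphism and a Hurewicz morphism. -/

import Mathlib

open CategoryTheory
open scoped Topology

universe u

namespace TopStk

/-- Compactly generated Hausdorff spaces. -/
structure CGTop : Type (u + 1) where
  of ::
  carrier : Type u
  [top : TopologicalSpace carrier]
  [t2 : T2Space carrier]
  [cg : CompactlyGeneratedSpace carrier]

namespace CGTop

instance : CoeSort CGTop.{u} (Type u) := ⟨CGTop.carrier⟩

instance (X : CGTop.{u}) : TopologicalSpace X := X.top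

instance (X : CGTop.{u}) : T2Space X := X.t2

instance (X : CGTop.{u}) : CompactlyGeneratedSpace X := X.cg

instance : Category CGTop.{u} where
  Hom X Y := C(X, Y)
  id X := ContinuousMap.id X
  comp f g := ContinuousMap.comp g f

end CGTop

/-- An open subspace of a compactly generated space is compactly generated. -/
theorem compactlyGeneratedSpace_of_isOpen_subset {Z : Type u} [TopologicalSpace Z]
    [CompactlyGeneratedSpace Z] {V : Set Z} (hV : IsOpen V) : CompactlyGeneratedSpace V := by
  refine compactlyGeneratedSpace_of_isOpen fun s hs => ?_
  rw [hV.isOpenEmbedding_subtypeVal.isOpen_iff_image_isOpen]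
  refine CompactlyGeneratedSpace.isOpen' fun K _ _ _ f hf => ?_
  rw [isOpen_iff_mem_nhds]
  intro k hk
  obtain ⟨v, hv, hvk⟩ := hk
  have hkV : f ⁻¹' V ∈ nhds k := (hV.preimage hf).mem_nhds (by
    change f k ∈ V; rw [← hvk]; exact v.2)
  obtain ⟨L, hL, hLV, hLc⟩ := LocallyCompactSpace.local_compact_nhds k _ hkV
  have : CompactSpace L := isCompact_iff_compactSpace.1 hLc
  let g : L → V := fun x => ⟨f x.1, hLV x.2⟩
  have hg : Continuous g := (hf.comp continuous_subtype_val).subtype_mk _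
  have h1 := hs L g hg
  obtain ⟨O, hO, hOe⟩ := isOpen_induced_iff.1 h1
  have hkO : k ∈ O := by
    have : (⟨k, mem_of_mem_nhds hL⟩ : L) ∈ Subtype.val ⁻¹' O := by
      rw [hOe]
      change g _ ∈ s
      have : g ⟨k, mem_of_mem_nhds hL⟩ = v := Subtype.ext hvk.symm
      rwa [this]
    exact this
  filter_upwards [hL, hO.mem_nhds hkO] with x hxL hxO
  have : (⟨x, hxL⟩ : L) ∈ g ⁻¹' s := by rw [← hOe]; exact hxO
  exact ⟨g ⟨x, hxL⟩, this, rfl⟩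

theorem kTop_le {X : Type u} (t : TopologicalSpace X) :
    @TopologicalSpace.compactlyGenerated.{u} X t ≤ t := by
  rw [← continuous_id_iff_le]
  exact continuous_from_compactlyGenerated.{u} _ fun S h => h.2

theorem continuous_kTop {X : Type u} (t : TopologicalSpace X) (S : CompHaus.{u}) (h : S → X)
    (hh : Continuous[inferInstance, t] h) :
    Continuous[inferInstance, @TopologicalSpace.compactlyGenerated.{u} X t] h := by
  let h' : C(S, X) := ⟨h, hh⟩
  let F : (Σ i : (S : CompHaus.{u}) × C(S, X), i.fst) → X := fun ⟨⟨_, i⟩, s⟩ ↦ i s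
  have hF : Continuous[inferInstance, @TopologicalSpace.compactlyGenerated.{u} X t] F :=
    continuous_coinduced_rng
  exact @Continuous.comp _ _ _ _ _ (@TopologicalSpace.compactlyGenerated.{u} X t)
    (Sigma.mk (β := fun i : (S : CompHaus.{u}) × C(S, X) => i.fst) ⟨S, h'⟩) F hF
    continuous_sigmaMk

theorem compactlyGeneratedSpace_kTop {X : Type u} (t : TopologicalSpace X) :
    @CompactlyGeneratedSpace X (@TopologicalSpace.compactlyGenerated.{u} X t) := by
  refine @uCompactlyGeneratedSpace_of_isOpen _ (@TopologicalSpace.compactlyGenerated.{u} X t)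
    fun s hs => ?_
  refine isOpen_coinduced.2 (isOpen_sigma_iff.2 fun i => ?_)
  exact hs i.1 (@ContinuousMap.mk _ _ _ (@TopologicalSpace.compactlyGenerated.{u} X t) _
    (continuous_kTop t i.1 _ i.2.2))

/-- The fibre product `A ×_B C` in compactly generated spaces: the set-theoretic fibre product,
whose topology is the compactly generated topology associated with the topology induced from
the product `A × C`. -/
structure FibProd {A B C : Type u} [TopologicalSpace A] [TopologicalSpace B] [TopologicalSpace C]
    (f : C(A, B)) (g : C(C, B)) : Type u where
  fst : A
  snd : C
  w : f fst = g snd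

namespace FibProd

variable {A B C : Type u} [TopologicalSpace A] [TopologicalSpace B] [TopologicalSpace C]
  {f : C(A, B)} {g : C(C, B)}

instance : TopologicalSpace (FibProd f g) :=
  @TopologicalSpace.compactlyGenerated.{u} (FibProd f g)
    (TopologicalSpace.induced (fun x => (x.fst, x.snd)) inferInstance)

instance : CompactlyGeneratedSpace (FibProd f g) := compactlyGeneratedSpace_kTop _

theorem continuous_pair : Continuous (fun x : FibProd f g => (x.fst, x.snd)) :=
  continuous_le_dom (kTop_le _) continuous_induced_dom

@[fun_prop]
theorem continuous_fst : Continuous (fun x : FibProd f g => x.fst) :=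
  _root_.continuous_fst.comp continuous_pair

@[fun_prop]
theorem continuous_snd : Continuous (fun x : FibProd f g => x.snd) :=
  _root_.continuous_snd.comp continuous_pair

theorem hom_ext {x y : FibProd f g} (h1 : x.fst = y.fst) (h2 : x.snd = y.snd) : x = y := by
  cases x; cases y; cases h1; cases h2; rfl

instance [T2Space A] [T2Space C] : T2Space (FibProd f g) :=
  .of_injective_continuous
    (fun _ _ h => hom_ext (congrArg Prod.fst h) (congrArg Prod.snd h)) continuous_pair

theorem continuous_mk {Z : Type u} [TopologicalSpace Z] [CompactlyGeneratedSpace Z]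
    {h : Z → A} {k : Z → C} (hh : Continuous h) (hk : Continuous k)
    (w : ∀ z, f (h z) = g (k z)) : Continuous (fun z => (⟨h z, k z, w z⟩ : FibProd f g)) :=
  continuous_from_uCompactlyGeneratedSpace.{u} _ fun S m =>
    continuous_kTop _ S _ (continuous_induced_rng.2 ((hh.comp m.2).prodMk (hk.comp m.2)))

end FibProd

/-- A topological groupoid: a groupoid internal to compactly generated Hausdorff spaces.
`comp ⟨g, h, _⟩` is the composite `g ∘ h`, defined when `src g = tgt h`. -/
structure TopGroupoid : Type (u + 1) where
  obj : CGTop.{u}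
  arr : CGTop.{u}
  src : C(arr, obj)
  tgt : C(arr, obj)
  one : C(obj, arr)
  inv : C(arr, arr)
  comp : C(FibProd src tgt, arr)
  src_one : ∀ a, src (one a) = a
  tgt_one : ∀ a, tgt (one a) = a
  src_inv : ∀ g, src (inv g) = tgt g
  tgt_inv : ∀ g, tgt (inv g) = src g
  src_comp : ∀ x, src (comp x) = src x.snd
  tgt_comp : ∀ x, tgt (comp x) = tgt x.fst
  one_comp : ∀ g w, comp ⟨one (tgt g), g, w⟩ = g
  comp_one : ∀ g w, comp ⟨g, one (src g), w⟩ = g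
  inv_comp : ∀ g w, comp ⟨inv g, g, w⟩ = one (src g)
  comp_inv : ∀ g w, comp ⟨g, inv g, w⟩ = one (tgt g)
  assoc : ∀ g h k w₁ w₂ w₃ w₄,
    comp ⟨comp ⟨g, h, w₁⟩, k, w₂⟩ = comp ⟨g, comp ⟨h, k, w₃⟩, w₄⟩

/-- A morphism of topological groupoids: a continuous functor. -/
structure TopGroupoid.Hom (G H : TopGroupoid.{u}) : Type u where
  onObj : C(G.obj, H.obj)
  onArr : C(G.arr, H.arr)
  src_onArr : ∀ g, H.src (onArr g) = onObj (G.src g)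
  tgt_onArr : ∀ g, H.tgt (onArr g) = onObj (G.tgt g)
  map_one : ∀ a, onArr (G.one a) = H.one (onObj a)
  map_comp : ∀ g h w w', onArr (G.comp ⟨g, h, w⟩) = H.comp ⟨onArr g, onArr h, w'⟩

/-- The groupoid `[X ⇉ X]` with only identity arrows. -/
def TopGroupoid.unit (X : CGTop.{u}) : TopGroupoid.{u} where
  obj := X
  arr := X
  src := ContinuousMap.id X
  tgt := ContinuousMap.id X
  one := ContinuousMap.id X
  inv := ContinuousMap.id X
  comp := ⟨fun x => x.fst, FibProd.continuous_fst⟩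
  src_one _ := rfl
  tgt_one _ := rfl
  src_inv _ := rfl
  tgt_inv _ := rfl
  src_comp x := x.w
  tgt_comp _ := rfl
  one_comp _ _ := rfl
  comp_one _ _ := rfl
  inv_comp _ _ := rfl
  comp_inv _ _ := rfl
  assoc _ _ _ _ _ _ _ := rfl

/-- `f` is a map of local sections: there are an open cover of `Y` and a continuous section of `f`
over each member of the cover. -/
def AdmitsLocalSections {X Y : Type u} [TopologicalSpace X] [TopologicalSpace Y]
    (f : C(X, Y)) : Prop :=
  ∀ y : Y, ∃ U : Set Y, IsOpen U ∧ y ∈ U ∧ ∃ σ : C(U, X), ∀ u : U, f (σ u) = u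

/-- A left action of a topological groupoid on a space. -/
structure LeftAction (G : TopGroupoid.{u}) (P : CGTop.{u}) : Type u where
  anchor : C(P, G.obj)
  act : C(FibProd G.src anchor, P)
  anchor_act : ∀ x, anchor (act x) = G.tgt x.fst
  one_act : ∀ p w, act ⟨G.one (anchor p), p, w⟩ = p
  act_act : ∀ γ γ' p w₁ w₂ w₃ w₄,
    act ⟨γ, act ⟨γ', p, w₁⟩, w₂⟩ = act ⟨G.comp ⟨γ, γ', w₃⟩, p, w₄⟩

/-- A right action of a topological groupoid on a space. -/
structure RightAction (G : TopGroupoid.{u}) (P : CGTop.{u}) : Type u where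
  anchor : C(P, G.obj)
  act : C(FibProd anchor G.tgt, P)
  anchor_act : ∀ x, anchor (act x) = G.src x.snd
  act_one : ∀ p w, act ⟨p, G.one (anchor p), w⟩ = p
  act_act : ∀ p γ γ' w₁ w₂ w₃ w₄,
    act ⟨act ⟨p, γ, w₁⟩, γ', w₂⟩ = act ⟨p, G.comp ⟨γ, γ', w₃⟩, w₄⟩

/-- A map `proj` and a right action of `G` on its source form a principal `G`-bundle. -/
structure IsPrincipal {G : TopGroupoid.{u}} {P M : CGTop.{u}} (proj : C(P, M))
    (R : RightAction G P) : Prop where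
  localSections : AdmitsLocalSections proj
  proj_act : ∀ x, proj (R.act x) = proj x.fst
  isHomeomorph : IsHomeomorph (fun x : FibProd R.anchor G.tgt =>
    (⟨x.fst, R.act x, (proj_act x).symm⟩ : FibProd proj proj))

/-- Principal `G`-bundles over `M`. -/
structure PrincipalBundle (G : TopGroupoid.{u}) (M : CGTop.{u}) : Type (u + 1) where
  total : CGTop.{u}
  proj : C(total, M)
  action : RightAction G total
  principal : IsPrincipal proj action

/-- A `G`-`H`-bibundle. -/
structure Bibundle (G H : TopGroupoid.{u}) : Type (u + 1) where
  total : CGTop.{u}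
  left : LeftAction G total
  right : RightAction H total
  principal : IsPrincipal left.anchor right
  anchor_left : ∀ x, right.anchor (left.act x) = right.anchor x.snd
  left_right : ∀ γ p δ w₁ w₂ w₃ w₄,
    left.act ⟨γ, right.act ⟨p, δ, w₁⟩, w₂⟩ = right.act ⟨left.act ⟨γ, p, w₃⟩, δ, w₄⟩

theorem RightAction.act_congr {G : TopGroupoid.{u}} {P : CGTop.{u}} (R : RightAction G P)
    {p p' : P} {γ γ' : G.arr} {w} {w'} (hp : p = p') (hγ : γ = γ') :
    R.act ⟨p, γ, w⟩ = R.act ⟨p', γ', w'⟩ := by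
  subst hp hγ; rfl

theorem LeftAction.act_congr {G : TopGroupoid.{u}} {P : CGTop.{u}} (L : LeftAction G P)
    {p p' : P} {γ γ' : G.arr} {w} {w'} (hγ : γ = γ') (hp : p = p') :
    L.act ⟨γ, p, w⟩ = L.act ⟨γ', p', w'⟩ := by
  subst hp hγ; rfl

theorem TopGroupoid.comp_congr (G : TopGroupoid.{u}) {g g' h h' : G.arr} {w} {w'} (hg : g = g')
    (hh : h = h') : G.comp ⟨g, h, w⟩ = G.comp ⟨g', h', w'⟩ := by
  subst hg hh; rfl

namespace IsPrincipal

variable {G : TopGroupoid.{u}} {P M : CGTop.{u}} {proj : C(P, M)} {R : RightAction G P}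

theorem proj_act' (hP : IsPrincipal proj R) (p : P) (γ : G.arr) (w) :
    proj (R.act ⟨p, γ, w⟩) = proj p := hP.proj_act ⟨p, γ, w⟩

theorem exists_div (hP : IsPrincipal proj R) :
    ∃ d : C(FibProd proj proj, G.arr), ∀ y, ∃ w : R.anchor y.fst = G.tgt (d y),
      R.act ⟨y.fst, d y, w⟩ = y.snd := by
  let e := hP.isHomeomorph.homeomorph
  refine ⟨⟨fun y => (e.symm y).snd, FibProd.continuous_snd.comp e.symm.continuous⟩, fun y => ?_⟩
  have h : e (e.symm y) = y := e.apply_symm_apply y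
  have h1 : (e.symm y).fst = y.fst := congrArg FibProd.fst h
  have h2 : R.act (e.symm y) = y.snd := congrArg FibProd.snd h
  refine ⟨by rw [← h1]; exact (e.symm y).w, ?_⟩
  rw [← h2]
  exact R.act_congr h1.symm rfl

/-- The arrow `γ` with `p · γ = p'`, for `p` and `p'` in the same fibre. -/
noncomputable def div (hP : IsPrincipal proj R) : C(FibProd proj proj, G.arr) :=
  hP.exists_div.choose

theorem anchor_eq (hP : IsPrincipal proj R) (y : FibProd proj proj) :
    R.anchor y.fst = G.tgt (hP.div y) :=
  (hP.exists_div.choose_spec y).1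

theorem act_div (hP : IsPrincipal proj R) (y : FibProd proj proj) :
    R.act ⟨y.fst, hP.div y, hP.anchor_eq y⟩ = y.snd :=
  (hP.exists_div.choose_spec y).2

theorem free (hP : IsPrincipal proj R) {p : P} {γ γ' : G.arr} {w} {w'}
    (h : R.act ⟨p, γ, w⟩ = R.act ⟨p, γ', w'⟩) : γ = γ' := by
  have := hP.isHomeomorph.injective (a₁ := ⟨p, γ, w⟩) (a₂ := ⟨p, γ', w'⟩) (FibProd.hom_ext rfl h)
  exact congrArg FibProd.snd this

theorem src_div (hP : IsPrincipal proj R) (y : FibProd proj proj) :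
    G.src (hP.div y) = R.anchor y.snd := by
  have h := R.anchor_act ⟨y.fst, hP.div y, hP.anchor_eq y⟩
  rw [hP.act_div] at h
  exact h.symm

theorem of_div (hs : AdmitsLocalSections proj) (hp : ∀ x, proj (R.act x) = proj x.fst)
    (d : FibProd proj proj → G.arr) (hd : Continuous d)
    (h₁ : ∀ y, ∃ w, R.act ⟨y.fst, d y, w⟩ = y.snd)
    (h₂ : ∀ p γ γ' w w', R.act ⟨p, γ, w⟩ = R.act ⟨p, γ', w'⟩ → γ = γ') : IsPrincipal proj R where
  localSections := hs
  proj_act := hp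
  isHomeomorph := by
    let e : FibProd R.anchor G.tgt ≃ₜ FibProd proj proj :=
      { toFun := fun x => ⟨x.fst, R.act x, (hp x).symm⟩
        invFun := fun y => ⟨y.fst, d y, (h₁ y).1⟩
        left_inv := fun x => FibProd.hom_ext rfl (h₂ x.fst _ _ (h₁ ⟨x.fst, R.act x, (hp x).symm⟩).1 x.w
          (h₁ ⟨x.fst, R.act x, (hp x).symm⟩).2)
        right_inv := fun y => FibProd.hom_ext rfl (h₁ y).2
        continuous_toFun := FibProd.continuous_mk FibProd.continuous_fst R.act.continuous _
        continuous_invFun := FibProd.continuous_mk FibProd.continuous_fst hd _ }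
    exact e.isHomeomorph

end IsPrincipal

namespace PrincipalBundle

/-- The principal `H`-bundle `t : H₁ → H₀`. -/
def unit (H : TopGroupoid.{u}) : PrincipalBundle H H.obj where
  total := H.arr
  proj := H.tgt
  action :=
    { anchor := H.src
      act := H.comp
      anchor_act := H.src_comp
      act_one := H.comp_one
      act_act := H.assoc }
  principal := by
    have key : ∀ γ δ : H.arr, ∀ w w' w'', H.comp ⟨H.inv γ, H.comp ⟨γ, δ, w⟩, w'⟩ =
        H.comp ⟨H.one (H.src γ), δ, w''⟩ := fun γ δ w w' w'' => by
      rw [← H.assoc (H.inv γ) γ δ (H.src_inv _) (by rw [H.src_comp]; exact w)]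
      exact H.comp_congr (H.inv_comp _ _) rfl
    have key' : ∀ γ δ : H.arr, ∀ w w', H.comp ⟨H.inv γ, H.comp ⟨γ, δ, w⟩, w'⟩ = δ :=
      fun γ δ w w' => by
        rw [key γ δ w w' (by rw [H.src_one]; exact w)]
        exact (H.comp_congr (by rw [w]) rfl).trans (H.one_comp δ (by rw [H.src_one]))
    refine IsPrincipal.of_div ?_ H.tgt_comp
      (fun y => H.comp ⟨H.inv y.fst, y.snd, by rw [H.src_inv]; exact y.w⟩) ?_ ?_ ?_
    · exact fun y => ⟨Set.univ, isOpen_univ, trivial,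
        ⟨fun u => H.one u.1, H.one.continuous.comp continuous_subtype_val⟩,
        fun u => H.tgt_one _⟩
    · exact H.comp.continuous.comp (FibProd.continuous_mk
        (H.inv.continuous.comp FibProd.continuous_fst) FibProd.continuous_snd _)
    · intro y
      refine ⟨by rw [H.tgt_comp, H.tgt_inv], ?_⟩
      change H.comp _ = _
      rw [← H.assoc y.fst (H.inv y.fst) y.snd (H.tgt_inv _).symm
        (by rw [H.src_comp, H.src_inv]; exact y.w)]
      exact (H.comp_congr ((H.comp_inv _ _).trans (by rw [y.w])) rfl).trans
        (H.one_comp y.snd (by rw [H.src_one]))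
    · intro p γ γ' w w' h
      have h' : H.comp ⟨p, γ, w⟩ = H.comp ⟨p, γ', w'⟩ := h
      have e1 := key' p γ w (by rw [H.tgt_comp, H.src_inv])
      have e2 := key' p γ' w' (by rw [H.tgt_comp, H.src_inv])
      rw [← e1, ← e2]
      exact H.comp_congr rfl h'

variable {G : TopGroupoid.{u}}

/-- The pullback of a principal bundle along a continuous map. -/
noncomputable def pullback {M N : CGTop.{u}} (f : C(N, M)) (P : PrincipalBundle G M) :
    PrincipalBundle G N where
  total := CGTop.of (FibProd f P.proj)
  proj := ⟨fun x => x.fst, FibProd.continuous_fst⟩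
  action :=
    { anchor := ⟨fun x => P.action.anchor x.snd,
        P.action.anchor.continuous.comp FibProd.continuous_snd⟩
      act := ⟨fun x => ⟨x.fst.fst, P.action.act ⟨x.fst.snd, x.snd, x.w⟩,
          x.fst.w.trans (P.principal.proj_act ⟨x.fst.snd, x.snd, x.w⟩).symm⟩,
        FibProd.continuous_mk (FibProd.continuous_fst.comp FibProd.continuous_fst)
          (P.action.act.continuous.comp (FibProd.continuous_mk
            (FibProd.continuous_snd.comp FibProd.continuous_fst) FibProd.continuous_snd _)) _⟩
      anchor_act := fun x => P.action.anchor_act ⟨x.fst.snd, x.snd, x.w⟩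
      act_one := fun p w => FibProd.hom_ext rfl (P.action.act_one p.snd w)
      act_act := fun p γ γ' w₁ w₂ w₃ w₄ =>
        FibProd.hom_ext rfl (P.action.act_act p.snd γ γ' w₁ w₂ w₃ w₄) }
  principal := by
    refine IsPrincipal.of_div ?_ (fun _ => rfl)
      (fun y => P.principal.div ⟨y.fst.snd, y.snd.snd, by
        rw [← y.fst.w, ← y.snd.w]; exact congrArg f y.w⟩) ?_ ?_ ?_
    · intro n
      obtain ⟨U, hU, hn, σ, hσ⟩ := P.principal.localSections (f n)
      have := compactlyGeneratedSpace_of_isOpen_subset (hU.preimage f.continuous)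
      refine ⟨f ⁻¹' U, hU.preimage f.continuous, hn,
        ⟨fun u => ⟨u.1, σ ⟨f u.1, u.2⟩, (hσ ⟨f u.1, u.2⟩).symm⟩, ?_⟩, fun _ => rfl⟩
      exact FibProd.continuous_mk continuous_subtype_val (σ.continuous.comp
        ((f.continuous.comp continuous_subtype_val).subtype_mk _)) _
    · exact P.principal.div.continuous.comp (FibProd.continuous_mk
        (FibProd.continuous_snd.comp FibProd.continuous_fst)
        (FibProd.continuous_snd.comp FibProd.continuous_snd) _)
    · intro y
      have hy : P.proj y.fst.snd = P.proj y.snd.snd := by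
        rw [← y.fst.w, ← y.snd.w]; exact congrArg f y.w
      exact ⟨P.principal.anchor_eq ⟨y.fst.snd, y.snd.snd, hy⟩,
        FibProd.hom_ext y.w (P.principal.act_div ⟨y.fst.snd, y.snd.snd, hy⟩)⟩
    · intro p γ γ' w w' h
      exact P.principal.free (congrArg FibProd.snd h)

end PrincipalBundle

/-- The bibundle `G₀ ×_{H₀} H₁` associated with a morphism of topological groupoids. -/
noncomputable def Bibundle.ofHom {G H : TopGroupoid.{u}} (φ : G.Hom H) : Bibundle G H where
  total := CGTop.of (FibProd φ.onObj H.tgt)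
  left :=
    { anchor := ⟨fun x => x.fst, FibProd.continuous_fst⟩
      act := ⟨fun x => ⟨G.tgt x.fst, H.comp ⟨φ.onArr x.fst, x.snd.snd,
            (φ.src_onArr _).trans ((congrArg φ.onObj x.w).trans x.snd.w)⟩,
          (φ.tgt_onArr _).symm.trans (H.tgt_comp ⟨φ.onArr x.fst, x.snd.snd, _⟩).symm⟩,
        FibProd.continuous_mk (G.tgt.continuous.comp FibProd.continuous_fst)
          (H.comp.continuous.comp (FibProd.continuous_mk
            (φ.onArr.continuous.comp FibProd.continuous_fst)
            (FibProd.continuous_snd.comp FibProd.continuous_snd)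
            fun x => (φ.src_onArr _).trans ((congrArg φ.onObj x.w).trans x.snd.w))) _⟩
      anchor_act := fun _ => rfl
      one_act := fun p w => FibProd.hom_ext (G.tgt_one _)
        ((H.comp_congr ((φ.map_one _).trans (congrArg H.one p.w)) rfl).trans
          (H.one_comp p.snd (by rw [H.src_one])))
      act_act := fun γ γ' p w₁ w₂ w₃ w₄ => FibProd.hom_ext (G.tgt_comp ⟨γ, γ', w₃⟩).symm
        (by
          have h : H.src (φ.onArr γ) = H.tgt (φ.onArr γ') := by
            rw [φ.src_onArr, φ.tgt_onArr, w₃]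
          refine (H.assoc (φ.onArr γ) (φ.onArr γ') p.snd h ?_ ?_ ?_).symm.trans
            (H.comp_congr (φ.map_comp γ γ' w₃ h).symm rfl)
          rw [H.src_comp, φ.src_onArr]
          exact (congrArg φ.onObj w₁).trans p.w) }
  right := ((PrincipalBundle.unit H).pullback φ.onObj).action
  principal := ((PrincipalBundle.unit H).pullback φ.onObj).principal
  anchor_left := fun x => H.src_comp _
  left_right := fun γ p δ w₁ w₂ w₃ w₄ => FibProd.hom_ext rfl (H.assoc _ _ _ _ _ _ _).symm

theorem continuous_of_local {Z M Y : Type u} [TopologicalSpace Z] [TopologicalSpace M]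
    [TopologicalSpace Y] {m : Z → M} (hm : Continuous m) {F : Z → Y}
    (h : ∀ a : M, ∃ U : Set M, IsOpen U ∧ a ∈ U ∧ Continuous fun z : m ⁻¹' U => F z) :
    Continuous F := by
  rw [continuous_iff_continuousAt]
  intro z
  obtain ⟨U, hU, hz, hc⟩ := h (m z)
  exact (continuousOn_iff_continuous_domRestrict.2 hc).continuousAt ((hU.preimage hm).mem_nhds hz)

namespace Bibundle

variable {G H : TopGroupoid.{u}} {M : CGTop.{u}} (P : PrincipalBundle G M) (Q : Bibundle G H)

/-- The orbit relation of the action of `G` on `P ×_{G₀} Q`, `(p, q) ↦ (p · γ, γ⁻¹ · q)`: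
it identifies `(p, γ · q)` with `(p · γ, q)`. -/
def tensorRel (x y : FibProd P.action.anchor Q.left.anchor) : Prop :=
  ∃ γ w₁ w₂, y.fst = P.action.act ⟨x.fst, γ, w₁⟩ ∧ x.snd = Q.left.act ⟨γ, y.snd, w₂⟩

/-- The orbit equivalence relation on `P ×_{G₀} Q`. -/
def tensorSetoid : Setoid (FibProd P.action.anchor Q.left.anchor) where
  r := tensorRel P Q
  iseqv :=
    { refl := fun x => ⟨G.one (P.action.anchor x.fst), (G.tgt_one _).symm,
        (G.src_one _).trans x.w, (P.action.act_one _ _).symm, by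
          refine (Q.left.one_act x.snd (G.src_one _)).symm.trans (Q.left.act_congr ?_ rfl)
          rw [x.w]⟩
      symm := by
        rintro x y ⟨γ, w₁, w₂, h₁, h₂⟩
        refine ⟨G.inv γ, ?_, ?_, ?_, ?_⟩
        · rw [h₁, P.action.anchor_act, G.tgt_inv]
        · rw [h₂, G.src_inv, Q.left.anchor_act]
        · have e := P.action.act_act x.fst γ (G.inv γ) w₁
            (by rw [P.action.anchor_act, G.tgt_inv]) (G.tgt_inv γ).symm (by rw [G.tgt_comp, w₁])
          refine ((P.action.act_congr h₁ rfl).trans (e.trans ?_)).symm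
          exact (P.action.act_congr (w' := by rw [G.tgt_one]) rfl
            ((G.comp_inv _ _).trans (by rw [w₁]))).trans
              (P.action.act_one x.fst (by rw [G.tgt_one]))
        · have e := Q.left.act_act (G.inv γ) γ y.snd w₂
            (by rw [Q.left.anchor_act, G.src_inv]) (G.src_inv γ) (by rw [G.src_comp, w₂])
          refine ((Q.left.act_congr rfl h₂).trans (e.trans ?_)).symm
          exact (Q.left.act_congr (w' := by rw [G.src_one])
            ((G.inv_comp _ _).trans (by rw [w₂])) rfl).trans
              (Q.left.one_act y.snd (by rw [G.src_one]))
      trans := by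
        rintro x y z ⟨γ, w₁, w₂, h₁, h₂⟩ ⟨δ, v₁, v₂, k₁, k₂⟩
        have hc : G.src γ = G.tgt δ := by rw [w₂, k₂, Q.left.anchor_act]
        refine ⟨G.comp ⟨γ, δ, hc⟩, ?_, ?_, ?_, ?_⟩
        · rw [G.tgt_comp, w₁]
        · rw [G.src_comp, v₂]
        · rw [k₁, ← P.action.act_act x.fst γ δ w₁ (by rw [P.action.anchor_act]; exact hc)]
          exact P.action.act_congr h₁ rfl
        · rw [h₂, ← Q.left.act_act γ δ z.snd v₂ (by rw [Q.left.anchor_act]; exact hc)]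
          exact Q.left.act_congr rfl k₂ }

/-- The quotient space `(P ×_{G₀} Q) / G`. -/
def Tensor : Type u := Quotient (tensorSetoid P Q)

namespace Tensor

instance : TopologicalSpace (Tensor P Q) :=
  inferInstanceAs (TopologicalSpace (Quotient (tensorSetoid P Q)))

instance : CompactlyGeneratedSpace (Tensor P Q) :=
  inferInstanceAs (CompactlyGeneratedSpace (Quotient (tensorSetoid P Q)))

variable {P Q}

/-- The class of a pair. -/
def mk (x : FibProd P.action.anchor Q.left.anchor) : Tensor P Q :=
  Quotient.mk (tensorSetoid P Q) x

theorem isQuotientMap_mk : Topology.IsQuotientMap (mk (P := P) (Q := Q)) := isQuotientMap_quotient_mk'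

theorem continuous_mk : Continuous (mk (P := P) (Q := Q)) := isQuotientMap_mk.continuous

theorem mk_surjective : Function.Surjective (mk (P := P) (Q := Q)) := isQuotientMap_mk.surjective

theorem mk_eq_iff {x y : FibProd P.action.anchor Q.left.anchor} :
    mk x = mk y ↔ tensorRel P Q x y :=
  ⟨fun h => Quotient.exact (s := tensorSetoid P Q) h,
    fun h => Quotient.sound (s := tensorSetoid P Q) h⟩

theorem mk_congr {p p' : P.total} {q q' : Q.total} {w} {w'} (hp : p = p') (hq : q = q') :
    mk (P := P) (Q := Q) ⟨p, q, w⟩ = mk ⟨p', q', w'⟩ := by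
  subst hp hq; rfl

theorem mk_act (p : P.total) (γ : G.arr) (q : Q.total) (w₁ w₂ w₃ w₄) :
    mk (P := P) (Q := Q) ⟨P.action.act ⟨p, γ, w₁⟩, q, w₂⟩ =
      mk ⟨p, Q.left.act ⟨γ, q, w₃⟩, w₄⟩ :=
  (mk_eq_iff.2 ⟨γ, w₁, w₃, rfl, rfl⟩).symm

theorem mk_inj {p : P.total} {q q' : Q.total} {w} {w'}
    (h : mk (P := P) (Q := Q) ⟨p, q, w⟩ = mk ⟨p, q', w'⟩) : q = q' := by
  obtain ⟨γ, w₁, w₂, h₁, h₂⟩ := mk_eq_iff.1 h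
  have hγ : γ = G.one (P.action.anchor p) :=
    P.principal.free (w' := by rw [G.tgt_one])
      (h₁.symm.trans (P.action.act_one p (by rw [G.tgt_one])).symm)
  refine h₂.trans ((Q.left.act_congr (hγ.trans ?_) rfl).trans
    (Q.left.one_act q' (G.src_one _)))
  exact congrArg G.one w'

variable (P Q)

/-- The projection `[(p, q)] ↦ π p`. -/
def proj : C(Tensor P Q, M) where
  toFun := Quotient.lift (s := tensorSetoid P Q) (fun x => P.proj x.fst) (by
    rintro x y ⟨γ, w₁, w₂, h₁, h₂⟩
    rw [h₁, P.principal.proj_act])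
  continuous_toFun :=
    Continuous.quotient_lift (P.proj.continuous.comp FibProd.continuous_fst) _

/-- The map `[(p, q)] ↦ a_H q`. -/
def anchor : C(Tensor P Q, H.obj) where
  toFun := Quotient.lift (s := tensorSetoid P Q) (fun x => Q.right.anchor x.snd) (by
    rintro x y ⟨γ, w₁, w₂, h₁, h₂⟩
    rw [h₂, Q.anchor_left])
  continuous_toFun :=
    Continuous.quotient_lift (Q.right.anchor.continuous.comp FibProd.continuous_snd) _

variable {P Q}

theorem proj_mk (x : FibProd P.action.anchor Q.left.anchor) :
    proj P Q (mk x) = P.proj x.fst := rfl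

theorem anchor_mk (x : FibProd P.action.anchor Q.left.anchor) :
    anchor P Q (mk x) = Q.right.anchor x.snd := rfl

theorem exists_coord (y : FibProd P.proj (proj P Q)) :
    ∃ (q : Q.total) (w : P.action.anchor y.fst = Q.left.anchor q), mk ⟨y.fst, q, w⟩ = y.snd := by
  obtain ⟨x, hx⟩ := mk_surjective y.snd
  let z : FibProd P.proj P.proj := ⟨y.fst, x.fst, by rw [y.w, ← hx, proj_mk]⟩
  have hs : G.src (P.principal.div z) = Q.left.anchor x.snd := by
    rw [P.principal.src_div]; exact x.w
  refine ⟨Q.left.act ⟨P.principal.div z, x.snd, hs⟩, ?_, ?_⟩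
  · rw [Q.left.anchor_act]; exact P.principal.anchor_eq z
  · rw [← hx, ← mk_act y.fst (P.principal.div z) x.snd (P.principal.anchor_eq z)
      ((P.action.anchor_act _).trans hs) hs]
    exact mk_congr (P.principal.act_div z) rfl

/-- The unique `q` with `x = [(p, q)]`, for `p` and `x` over the same point. -/
noncomputable def coord (y : FibProd P.proj (proj P Q)) : Q.total := (exists_coord y).choose

theorem coord_w (y : FibProd P.proj (proj P Q)) :
    P.action.anchor y.fst = Q.left.anchor (coord y) := (exists_coord y).choose_spec.choose

theorem mk_coord (y : FibProd P.proj (proj P Q)) :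
    mk ⟨y.fst, coord y, coord_w y⟩ = y.snd := (exists_coord y).choose_spec.choose_spec

theorem coord_eq {y : FibProd P.proj (proj P Q)} {q : Q.total} (w)
    (h : mk ⟨y.fst, q, w⟩ = y.snd) : coord y = q :=
  mk_inj ((mk_coord y).trans h.symm)

theorem coord_mk (p : P.total) (x : FibProd P.action.anchor Q.left.anchor)
    (w : P.proj p = P.proj x.fst) :
    coord ⟨p, mk x, w⟩ = Q.left.act ⟨P.principal.div ⟨p, x.fst, w⟩, x.snd,
      (P.principal.src_div _).trans x.w⟩ := by
  have hs := (P.principal.src_div ⟨p, x.fst, w⟩).trans x.w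
  refine coord_eq (by rw [Q.left.anchor_act]; exact P.principal.anchor_eq ⟨p, x.fst, w⟩) ?_
  rw [← mk_act p _ x.snd (P.principal.anchor_eq ⟨p, x.fst, w⟩) ((P.action.anchor_act _).trans hs)]
  exact mk_congr (P.principal.act_div ⟨p, x.fst, w⟩) rfl

theorem continuous_coord {U : Set M} (hU : IsOpen U) (σ : C(U, P.total))
    (hσ : ∀ m : U, P.proj (σ m) = m) :
    Continuous fun x : proj P Q ⁻¹' U => coord ⟨σ ⟨proj P Q x, x.2⟩, x.1, hσ _⟩ := by
  have hV : IsOpen (proj P Q ⁻¹' U) := hU.preimage (proj P Q).continuous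
  have hq := (isQuotientMap_mk (P := P) (Q := Q)).restrictPreimage_isOpen hV
  rw [hq.continuous_iff]
  have : CompactlyGeneratedSpace (mk (P := P) (Q := Q) ⁻¹' (proj P Q ⁻¹' U)) :=
    compactlyGeneratedSpace_of_isOpen_subset (hV.preimage continuous_mk)
  have key : Continuous fun x : mk (P := P) (Q := Q) ⁻¹' (proj P Q ⁻¹' U) =>
      Q.left.act ⟨P.principal.div ⟨σ ⟨P.proj x.1.fst, x.2⟩, x.1.fst, hσ _⟩, x.1.snd,
        (P.principal.src_div _).trans x.1.w⟩ := by
    have c1 : Continuous fun x : mk (P := P) (Q := Q) ⁻¹' (proj P Q ⁻¹' U) => x.1.fst :=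
      FibProd.continuous_fst.comp continuous_subtype_val
    refine Q.left.act.continuous.comp (FibProd.continuous_mk ?_
      (FibProd.continuous_snd.comp continuous_subtype_val) _)
    refine P.principal.div.continuous.comp (FibProd.continuous_mk ?_ c1 _)
    exact σ.continuous.comp ((P.proj.continuous.comp c1).subtype_mk _)
  convert key using 2 with x
  exact coord_mk _ _ _

instance : T2Space (Tensor P Q) := by
  constructor
  intro x y hxy
  by_cases h : proj P Q x = proj P Q y
  · obtain ⟨U, hU, hm, σ, hσ⟩ := P.principal.localSections (proj P Q x)
    have hV : IsOpen (proj P Q ⁻¹' U) := hU.preimage (proj P Q).continuous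
    let c : proj P Q ⁻¹' U → Q.total := fun x => coord ⟨σ ⟨proj P Q x, x.2⟩, x.1, hσ _⟩
    have hc : Continuous c := continuous_coord hU σ hσ
    have hmy : proj P Q y ∈ U := h ▸ hm
    have hne : c ⟨x, hm⟩ ≠ c ⟨y, hmy⟩ := by
      intro e
      apply hxy
      have e1 := mk_coord (P := P) (Q := Q) ⟨σ ⟨proj P Q x, hm⟩, x, hσ _⟩
      have e2 := mk_coord (P := P) (Q := Q) ⟨σ ⟨proj P Q y, hmy⟩, y, hσ _⟩
      refine e1.symm.trans (Eq.trans (mk_congr ?_ e) e2)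
      exact congrArg σ (Subtype.ext h)
    obtain ⟨A, B, hA, hB, hxA, hyB, hAB⟩ := t2_separation hne
    refine ⟨Subtype.val '' (c ⁻¹' A), Subtype.val '' (c ⁻¹' B),
      hV.isOpenMap_subtype_val _ (hA.preimage hc), hV.isOpenMap_subtype_val _ (hB.preimage hc),
      ⟨_, hxA, rfl⟩, ⟨_, hyB, rfl⟩, ?_⟩
    rw [Set.disjoint_image_iff Subtype.val_injective]
    exact hAB.preimage c
  · obtain ⟨A, B, hA, hB, hxA, hyB, hAB⟩ := t2_separation h
    exact ⟨_, _, hA.preimage (proj P Q).continuous, hB.preimage (proj P Q).continuous, hxA, hyB,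
      hAB.preimage _⟩

/-- The right action `[(p, q)] · δ = [(p, q · δ)]`, as a function. -/
noncomputable def actFun (x : FibProd (anchor P Q) H.tgt) : Tensor P Q :=
  mk ⟨(Quotient.out x.fst : FibProd P.action.anchor Q.left.anchor).fst,
    Q.right.act ⟨(Quotient.out x.fst : FibProd P.action.anchor Q.left.anchor).snd, x.snd, by
      rw [← x.w, ← anchor_mk]
      exact congrArg (anchor P Q) (Quotient.out_eq x.fst)⟩,
    (Quotient.out x.fst : FibProd P.action.anchor Q.left.anchor).w.trans
      (Q.principal.proj_act' _ _ _).symm⟩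

theorem actFun_mk (x : FibProd P.action.anchor Q.left.anchor) (δ : H.arr) (w w₁ w₂) :
    actFun (P := P) (Q := Q) ⟨mk x, δ, w⟩ = mk ⟨x.fst, Q.right.act ⟨x.snd, δ, w₁⟩, w₂⟩ := by
  unfold actFun
  have h : mk (P := P) (Q := Q) (Quotient.out (mk x)) = mk x := Quotient.out_eq (mk x)
  rw [mk_eq_iff] at h ⊢
  obtain ⟨γ, v₁, v₂, h₁, h₂⟩ := h
  refine ⟨γ, v₁, ?_, h₁, ?_⟩
  · exact v₂.trans (Q.principal.proj_act' _ _ _).symm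
  · rw [Q.left_right γ x.snd δ w₁ _ v₂ (by rw [Q.anchor_left]; exact w₁)]
    exact Q.right.act_congr h₂ rfl

theorem actFun_eq {y : FibProd P.proj (proj P Q)} {δ : H.arr} (w) (w₁ w₂) :
    actFun (P := P) (Q := Q) ⟨y.snd, δ, w⟩ =
      mk ⟨y.fst, Q.right.act ⟨coord y, δ, w₁⟩, w₂⟩ := by
  rw [← actFun_mk ⟨y.fst, coord y, coord_w y⟩ δ w₁]
  congr 1
  exact FibProd.hom_ext (mk_coord y).symm rfl

theorem anchor_coord (y : FibProd P.proj (proj P Q)) :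
    Q.right.anchor (coord y) = anchor P Q y.snd := by
  rw [← mk_coord y]
  rfl

theorem continuous_actFun : Continuous (actFun (P := P) (Q := Q)) := by
  refine continuous_of_local ((proj P Q).continuous.comp FibProd.continuous_fst) fun m => ?_
  obtain ⟨U, hU, hm, σ, hσ⟩ := P.principal.localSections m
  refine ⟨U, hU, hm, ?_⟩
  have := compactlyGeneratedSpace_of_isOpen_subset (Z := FibProd (anchor P Q) H.tgt)
    (hU.preimage ((proj P Q).continuous.comp FibProd.continuous_fst))
  have hf : Continuous fun z : (⇑(proj P Q) ∘ fun x : FibProd (anchor P Q) H.tgt => x.fst) ⁻¹' U =>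
      z.1.fst := FibProd.continuous_fst.comp continuous_subtype_val
  have hc := (continuous_coord (P := P) (Q := Q) hU σ hσ).comp (hf.subtype_mk fun z => z.2)
  have key : Continuous
      fun z : (⇑(proj P Q) ∘ fun x : FibProd (anchor P Q) H.tgt => x.fst) ⁻¹' U =>
      mk (P := P) (Q := Q) ⟨σ ⟨proj P Q z.1.fst, z.2⟩,
        Q.right.act ⟨coord ⟨σ ⟨proj P Q z.1.fst, z.2⟩, z.1.fst, hσ _⟩, z.1.snd,
          (anchor_coord _).trans z.1.w⟩,
        (coord_w ⟨σ ⟨proj P Q z.1.fst, z.2⟩, z.1.fst, hσ _⟩).trans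
          (Q.principal.proj_act' _ _ _).symm⟩ := by
    refine continuous_mk.comp (FibProd.continuous_mk ?_ ?_ _)
    · exact σ.continuous.comp (((proj P Q).continuous.comp hf).subtype_mk _)
    · exact Q.right.act.continuous.comp
        (FibProd.continuous_mk hc (FibProd.continuous_snd.comp continuous_subtype_val) _)
  convert key using 2 with z
  exact actFun_eq (y := ⟨σ ⟨proj P Q z.1.fst, z.2⟩, z.1.fst, hσ _⟩) _ _ _

theorem actFun_free {x : Tensor P Q} {δ δ' : H.arr} {w} {w'}
    (h : actFun (P := P) (Q := Q) ⟨x, δ, w⟩ = actFun ⟨x, δ', w'⟩) : δ = δ' := by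
  obtain ⟨e, rfl⟩ := mk_surjective x
  rw [actFun_mk e δ w w (e.w.trans (Q.principal.proj_act' _ _ _).symm),
    actFun_mk e δ' w' w' (e.w.trans (Q.principal.proj_act' _ _ _).symm)] at h
  exact Q.principal.free (mk_inj h)

theorem proj_actFun (x : FibProd (anchor P Q) H.tgt) :
    proj P Q (actFun x) = proj P Q x.fst := by
  obtain ⟨x, δ, w⟩ := x
  obtain ⟨e, rfl⟩ := mk_surjective x
  rw [actFun_mk e δ w w (e.w.trans (Q.principal.proj_act' _ _ _).symm)]
  rfl

theorem div_w (p : P.total) (y : FibProd (proj P Q) (proj P Q)) (w : P.proj p = proj P Q y.fst) :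
    Q.left.anchor (coord ⟨p, y.fst, w⟩) = Q.left.anchor (coord ⟨p, y.snd, w.trans y.w⟩) :=
  (coord_w ⟨p, y.fst, w⟩).symm.trans (coord_w ⟨p, y.snd, w.trans y.w⟩)

theorem actFun_div (p : P.total) (y : FibProd (proj P Q) (proj P Q))
    (w : P.proj p = proj P Q y.fst) :
    ∃ v, actFun ⟨y.fst, Q.principal.div ⟨coord ⟨p, y.fst, w⟩, coord ⟨p, y.snd, w.trans y.w⟩,
      div_w p y w⟩, v⟩ = y.snd := by
  have h := Q.principal.anchor_eq
    ⟨coord ⟨p, y.fst, w⟩, coord ⟨p, y.snd, w.trans y.w⟩, div_w p y w⟩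
  refine ⟨(anchor_coord ⟨p, y.fst, w⟩).symm.trans h, ?_⟩
  rw [actFun_eq (y := ⟨p, y.fst, w⟩) _ h
    ((coord_w ⟨p, y.fst, w⟩).trans (Q.principal.proj_act' _ _ _).symm)]
  refine Eq.trans (mk_congr rfl ?_) (mk_coord ⟨p, y.snd, w.trans y.w⟩)
  exact Q.principal.act_div ⟨coord ⟨p, y.fst, w⟩, coord ⟨p, y.snd, w.trans y.w⟩, div_w p y w⟩

theorem exists_lift (m : M) (x : Tensor P Q) (h : proj P Q x = m) : ∃ p : P.total, P.proj p = m := by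
  obtain ⟨e, rfl⟩ := mk_surjective x
  exact ⟨e.fst, h⟩

end Tensor

/-- The principal `H`-bundle `(P ×_{G₀} Q) / G` over `M` obtained by composing a principal
`G`-bundle `P` over `M` with a bibundle `Q` from `G` to `H`. -/
noncomputable def tensor : PrincipalBundle H M where
  total := CGTop.of (Tensor P Q)
  proj := Tensor.proj P Q
  action :=
    { anchor := Tensor.anchor P Q
      act := ⟨Tensor.actFun, Tensor.continuous_actFun⟩
      anchor_act := by
        rintro ⟨x, δ, w⟩
        obtain ⟨e, rfl⟩ := Tensor.mk_surjective x
        change Tensor.anchor P Q (Tensor.actFun _) = _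
        rw [Tensor.actFun_mk e δ w w (e.w.trans (Q.principal.proj_act' _ _ _).symm)]
        exact Q.right.anchor_act _
      act_one := by
        intro x w
        obtain ⟨e, rfl⟩ := Tensor.mk_surjective x
        change Tensor.actFun _ = _
        rw [Tensor.actFun_mk e _ w w (e.w.trans (Q.principal.proj_act' _ _ _).symm)]
        exact Tensor.mk_congr rfl (Q.right.act_one _ _)
      act_act := by
        intro x γ γ' w₁ w₂ w₃ w₄
        obtain ⟨e, rfl⟩ := Tensor.mk_surjective x
        change Tensor.actFun _ = Tensor.actFun _
        have e1 := Tensor.actFun_mk e γ w₁ w₁ (e.w.trans (Q.principal.proj_act' _ _ _).symm)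
        have hw : Q.right.anchor (Q.right.act ⟨e.snd, γ, w₁⟩) = H.tgt γ' := by
          rw [Q.right.anchor_act]; exact w₃
        rw [Tensor.actFun_mk e _ w₄ w₄ (e.w.trans (Q.principal.proj_act' _ _ _).symm)]
        refine Eq.trans (congrArg Tensor.actFun (FibProd.hom_ext (y := ⟨Tensor.mk
          ⟨e.fst, Q.right.act ⟨e.snd, γ, w₁⟩, e.w.trans (Q.principal.proj_act' _ _ _).symm⟩, γ', hw⟩)
          e1 rfl)) ?_
        exact (Tensor.actFun_mk ⟨e.fst, Q.right.act ⟨e.snd, γ, w₁⟩,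
          e.w.trans (Q.principal.proj_act' _ _ _).symm⟩ γ' hw hw
          ((e.w.trans (Q.principal.proj_act' _ _ _).symm).trans
            (Q.principal.proj_act' _ _ _).symm)).trans
          (Tensor.mk_congr rfl (Q.right.act_act _ _ _ _ _ _ _)) }
  principal := by
    have hd : ∀ y : FibProd (Tensor.proj P Q) (Tensor.proj P Q), ∃ δ, ∃ v,
        Tensor.actFun ⟨y.fst, δ, v⟩ = y.snd := fun y => by
      obtain ⟨p, hp⟩ := Tensor.exists_lift _ y.fst rfl
      exact ⟨_, Tensor.actFun_div p y hp⟩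
    refine IsPrincipal.of_div ?_ Tensor.proj_actFun (fun y => (hd y).choose) ?_
      (fun y => (hd y).choose_spec) (fun _ _ _ _ _ h => Tensor.actFun_free h)
    · intro m
      obtain ⟨U, hU, hm, σ, hσ⟩ := P.principal.localSections m
      obtain ⟨V, hV, hmV, τ, hτ⟩ :=
        Q.principal.localSections (P.action.anchor (σ ⟨m, hm⟩))
      let f : C(U, G.obj) := P.action.anchor.comp σ
      let W : Set M := Subtype.val '' (f ⁻¹' V)
      have hW : IsOpen W := hU.isOpenMap_subtype_val _ (hV.preimage f.continuous)
      have := compactlyGeneratedSpace_of_isOpen_subset hW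
      have hWU : ∀ x : W, x.1 ∈ U := by rintro ⟨_, x, _, rfl⟩; exact x.2
      have hWV : ∀ x : W, f ⟨x.1, hWU x⟩ ∈ V := by rintro ⟨_, x, hx, rfl⟩; exact hx
      have c1 : Continuous fun x : W => (⟨x.1, hWU x⟩ : U) := continuous_subtype_val.subtype_mk _
      refine ⟨W, hW, ⟨_, hmV, rfl⟩,
        ⟨fun x => Tensor.mk ⟨σ ⟨x.1, hWU x⟩, τ ⟨_, hWV x⟩,
          (hτ ⟨f ⟨x.1, hWU x⟩, hWV x⟩).symm⟩, ?_⟩, fun x => hσ _⟩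
      exact Tensor.continuous_mk.comp (FibProd.continuous_mk (σ.continuous.comp c1)
        (τ.continuous.comp ((f.continuous.comp c1).subtype_mk _)) _)
    · refine continuous_of_local ((Tensor.proj P Q).continuous.comp FibProd.continuous_fst)
        fun m => ?_
      obtain ⟨U, hU, hm, σ, hσ⟩ := P.principal.localSections m
      refine ⟨U, hU, hm, ?_⟩
      have := compactlyGeneratedSpace_of_isOpen_subset
        (Z := FibProd (Tensor.proj P Q) (Tensor.proj P Q))
        (hU.preimage ((Tensor.proj P Q).continuous.comp FibProd.continuous_fst))
      let Z := (⇑(Tensor.proj P Q) ∘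
        fun x : FibProd (Tensor.proj P Q) (Tensor.proj P Q) => x.fst) ⁻¹' U
      have hf : Continuous fun z : Z => z.1.fst :=
        FibProd.continuous_fst.comp continuous_subtype_val
      have hs : Continuous fun z : Z => z.1.snd :=
        FibProd.continuous_snd.comp continuous_subtype_val
      have hU2 : ∀ z : Z, Tensor.proj P Q z.1.snd ∈ U := fun z => z.1.w ▸ z.2
      have hc1 := (Tensor.continuous_coord (P := P) (Q := Q) hU σ hσ).comp
        (hf.subtype_mk fun z => z.2)
      have hc2 := (Tensor.continuous_coord (P := P) (Q := Q) hU σ hσ).comp (hs.subtype_mk hU2)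
      have hw : ∀ z : Z, P.proj (σ ⟨Tensor.proj P Q z.1.fst, z.2⟩) = Tensor.proj P Q z.1.fst :=
        fun z => hσ _
      have key : Continuous fun z : Z => Q.principal.div
          ⟨Tensor.coord ⟨σ ⟨Tensor.proj P Q z.1.fst, z.2⟩, z.1.fst, hw z⟩,
            Tensor.coord ⟨σ ⟨Tensor.proj P Q z.1.fst, z.2⟩, z.1.snd, (hw z).trans z.1.w⟩,
            Tensor.div_w _ _ _⟩ := by
        refine Q.principal.div.continuous.comp (FibProd.continuous_mk hc1 ?_ _)
        convert hc2 using 2 with z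
        refine congrArg Tensor.coord (FibProd.hom_ext ?_ rfl)
        exact congrArg σ (Subtype.ext z.1.w)
      convert key using 2 with z
      obtain ⟨v, hv⟩ := Tensor.actFun_div (σ ⟨Tensor.proj P Q z.1.fst, z.2⟩) z.1 (hw z)
      exact Tensor.actFun_free ((hd z.1).choose_spec.choose_spec.trans hv.symm)

end Bibundle

/-! ### Stacks over compactly generated spaces -/

/-- Objects of `BG`: principal `G`-bundles over arbitrary bases. -/
structure BObj (G : TopGroupoid.{u}) : Type (u + 1) where
  base : CGTop.{u}
  bundle : PrincipalBundle G base

/-- Morphisms of principal `G`-bundles. -/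
@[ext]
structure BHom {G : TopGroupoid.{u}} (P Q : BObj G) : Type u where
  onBase : C(P.base, Q.base)
  onTotal : C(P.bundle.total, Q.bundle.total)
  anchor_onTotal : ∀ p, Q.bundle.action.anchor (onTotal p) = P.bundle.action.anchor p
  map_act : ∀ p γ w w',
    onTotal (P.bundle.action.act ⟨p, γ, w⟩) = Q.bundle.action.act ⟨onTotal p, γ, w'⟩
  proj_onTotal : ∀ p, Q.bundle.proj (onTotal p) = onBase (P.bundle.proj p)

instance (G : TopGroupoid.{u}) : Category (BObj G) where
  Hom := BHom
  id P :=
    { onBase := ContinuousMap.id _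
      onTotal := ContinuousMap.id _
      anchor_onTotal := fun _ => rfl
      map_act := fun _ _ _ _ => rfl
      proj_onTotal := fun _ => rfl }
  comp {P Q R} F K :=
    { onBase := K.onBase.comp F.onBase
      onTotal := K.onTotal.comp F.onTotal
      anchor_onTotal := fun p => (K.anchor_onTotal _).trans (F.anchor_onTotal p)
      map_act := fun p γ w w' =>
        (congrArg K.onTotal (F.map_act p γ w ((F.anchor_onTotal p).trans w))).trans
          (K.map_act _ _ _ _)
      proj_onTotal := fun p => (K.proj_onTotal _).trans (congrArg K.onBase (F.proj_onTotal p)) }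

/-- The stack `BG` of principal `G`-bundles, as a category over compactly generated spaces. -/
def B (G : TopGroupoid.{u}) : BasedCategory.{u, u + 1} CGTop.{u} :=
  BasedCategory.ofFunctor
    { obj := fun P : BObj G => P.base
      map := fun F => BHom.onBase F }

/-- The map `(P ×_{G₀} Q) / G → (P' ×_{G₀} Q) / G` induced by a morphism `P → P'`. -/
def Bibundle.tensorMap {G H : TopGroupoid.{u}} (Q : Bibundle G H) {P P' : BObj G} (F : BHom P P') :
    C(Tensor P.bundle Q, Tensor P'.bundle Q) where
  toFun := Quotient.lift (s := tensorSetoid P.bundle Q)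
    (fun x => Tensor.mk ⟨F.onTotal x.fst, x.snd, (F.anchor_onTotal _).trans x.w⟩) (by
      rintro x y ⟨γ, w₁, w₂, h₁, h₂⟩
      exact Tensor.mk_eq_iff.2 ⟨γ, (F.anchor_onTotal _).trans w₁, w₂,
        (congrArg F.onTotal h₁).trans (F.map_act _ _ _ _), h₂⟩)
  continuous_toFun := Continuous.quotient_lift (Tensor.continuous_mk.comp
    (FibProd.continuous_mk (F.onTotal.continuous.comp FibProd.continuous_fst)
      FibProd.continuous_snd _)) _

/-- The morphism of stacks `BG → BH`, `P ↦ (P ×_{G₀} Q) / G`, of a bibundle `Q` from `G` to `H`. -/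
noncomputable def B.mapBibundle {G H : TopGroupoid.{u}} (Q : Bibundle G H) :
    BasedFunctor (B G) (B H) where
  obj := fun P : BObj G => (⟨P.base, Bibundle.tensor P.bundle Q⟩ : BObj H)
  map := fun {P P' : BObj G} (F : BHom P P') =>
    ({ onBase := F.onBase
       onTotal := Q.tensorMap F
       anchor_onTotal := by
        intro x
        obtain ⟨e, rfl⟩ := Bibundle.Tensor.mk_surjective x
        rfl
       map_act := by
        intro x δ w w'
        obtain ⟨e, rfl⟩ := Bibundle.Tensor.mk_surjective x
        have h1 := Bibundle.Tensor.actFun_mk e δ w w (e.w.trans (Q.principal.proj_act' _ _ _).symm)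
        have h2 := Bibundle.Tensor.actFun_mk
          (⟨F.onTotal e.fst, e.snd, (F.anchor_onTotal _).trans e.w⟩ :
            FibProd P'.bundle.action.anchor Q.left.anchor) δ w' w'
          (((F.anchor_onTotal _).trans e.w).trans (Q.principal.proj_act' _ _ _).symm)
        exact (congrArg (Q.tensorMap F) h1).trans h2.symm
       proj_onTotal := by
        intro x
        obtain ⟨e, rfl⟩ := Bibundle.Tensor.mk_surjective x
        exact F.proj_onTotal _ } : BHom (G := H) ⟨P.base, _⟩ ⟨P'.base, _⟩)
  map_id := fun P => BHom.ext rfl (ContinuousMap.ext fun x => by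
    obtain ⟨e, rfl⟩ := Bibundle.Tensor.mk_surjective x
    rfl)
  map_comp := fun {P P' P'' : BObj G} (F : BHom P P') (K : BHom P' P'') => BHom.ext rfl (ContinuousMap.ext fun x => by
    obtain ⟨e, rfl⟩ := Bibundle.Tensor.mk_surjective x
    rfl)
  w := rfl

/-- The morphism of stacks `BG → BH` induced by a morphism of topological groupoids `G → H`. -/
noncomputable def B.map {G H : TopGroupoid.{u}} (φ : G.Hom H) : BasedFunctor (B G) (B H) :=
  B.mapBibundle (Bibundle.ofHom φ)

/-- The stack `U` represented by a space `U`. -/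
def spaceStack (U : CGTop.{u}) : BasedCategory.{u, u + 1} CGTop.{u} :=
  BasedCategory.ofFunctor (Over.forget U)

/-! #### Pullback in fibred categories -/

section Descent

universe v₁ v₂ u₁ u₂

variable {𝒮 : Type u₁} [Category.{v₁} 𝒮] {𝒳 : Type u₂} [Category.{v₂} 𝒳] {p : 𝒳 ⥤ 𝒮}
  [p.IsFibered]

open Functor Functor.IsPreFibered

/-- The pullback functor `f^*` between fibres of a fibred category. -/
noncomputable def fiberPullback {R S : 𝒮} (f : R ⟶ S) : Fiber p S ⥤ Fiber p R where
  obj a := ⟨pullbackObj a.2 f, pullbackObj_proj a.2 f⟩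
  map {a b} φ :=
    have := φ.2
    ⟨IsCartesian.map p f (pullbackMap b.2 f) (pullbackMap a.2 f ≫ φ.1), inferInstance⟩
  map_id a := by
    apply Subtype.ext
    symm
    have : p.IsHomLift (𝟙 R) (𝟙 (pullbackObj a.2 f)) := IsHomLift.id (pullbackObj_proj a.2 f)
    have h2 := (𝟙 a : a ⟶ a).2
    refine IsCartesian.map_uniq p f _ _ (𝟙 _) ?_
    exact (Category.id_comp _).trans (Category.comp_id _).symm
  map_comp {a b c} φ ψ := by
    apply Subtype.ext
    symm
    have h1 := φ.2
    have h2 := ψ.2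
    have h3 := (φ ≫ ψ).2
    refine IsCartesian.map_uniq p f _ _ (IsCartesian.map p f _ _ ≫ IsCartesian.map p f _ _) ?_
    rw [Category.assoc, IsCartesian.fac, IsCartesian.fac_assoc, Category.assoc]
    rfl

/-- The canonical arrow `f^* a ⟶ a`. -/
noncomputable def fiberPullbackArrow {R S : 𝒮} (f : R ⟶ S) (a : Fiber p S) :
    ((fiberPullback f).obj a).1 ⟶ a.1 := pullbackMap a.2 f

instance {R S : 𝒮} (f : R ⟶ S) (a : Fiber p S) : p.IsCartesian f (fiberPullbackArrow f a) :=
  inferInstanceAs (p.IsCartesian f (pullbackMap a.2 f))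

theorem fiberPullback_map_arrow {R S : 𝒮} (f : R ⟶ S) {a b : Fiber p S} (φ : a ⟶ b) :
    ((fiberPullback f).map φ).1 ≫ fiberPullbackArrow f b = fiberPullbackArrow f a ≫ φ.1 := by
  have := φ.2
  exact IsCartesian.fac p f (pullbackMap b.2 f) (pullbackMap a.2 f ≫ φ.1)

theorem fiberPullback_hom_ext {R S : 𝒮} (f : R ⟶ S) {a : Fiber p S} {z : Fiber p R}
    {φ ψ : z ⟶ (fiberPullback f).obj a}
    (h : φ.1 ≫ fiberPullbackArrow f a = ψ.1 ≫ fiberPullbackArrow f a) : φ = ψ := by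
  have h1 := φ.2
  have h2 := ψ.2
  exact Subtype.ext (IsCartesian.ext p f (fiberPullbackArrow f a) _ _ h)

/-- The canonical isomorphism `f^* g^* a ≅ h^* a`, where `h = g ∘ f`. -/
noncomputable def fiberPullbackComp {T R S : 𝒮} (f : T ⟶ R) (g : R ⟶ S) (h : T ⟶ S)
    (w : f ≫ g = h) (a : Fiber p S) :
    (fiberPullback f).obj ((fiberPullback g).obj a) ≅ (fiberPullback h).obj a :=
  have : p.IsCartesian h
      (fiberPullbackArrow f ((fiberPullback g).obj a) ≫ fiberPullbackArrow g a) := by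
    rw [← w]; infer_instance
  { hom := ⟨IsCartesian.map p h (fiberPullbackArrow h a)
      (fiberPullbackArrow f ((fiberPullback g).obj a) ≫ fiberPullbackArrow g a), inferInstance⟩
    inv := ⟨IsCartesian.map p h
      (fiberPullbackArrow f ((fiberPullback g).obj a) ≫ fiberPullbackArrow g a)
      (fiberPullbackArrow h a), inferInstance⟩
    hom_inv_id := Subtype.ext (IsCartesian.domainUniqueUpToIso p h (fiberPullbackArrow h a)
      (fiberPullbackArrow f ((fiberPullback g).obj a) ≫ fiberPullbackArrow g a)).hom_inv_id
    inv_hom_id := Subtype.ext (IsCartesian.domainUniqueUpToIso p h (fiberPullbackArrow h a)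
      (fiberPullbackArrow f ((fiberPullback g).obj a) ≫ fiberPullbackArrow g a)).inv_hom_id }

theorem fiberPullbackComp_hom_arrow {T R S : 𝒮} (f : T ⟶ R) (g : R ⟶ S) (h : T ⟶ S)
    (w : f ≫ g = h) (a : Fiber p S) :
    (fiberPullbackComp f g h w a).hom.1 ≫ fiberPullbackArrow h a =
      fiberPullbackArrow f ((fiberPullback g).obj a) ≫ fiberPullbackArrow g a := by
  subst w
  exact IsCartesian.fac p (f ≫ g) (fiberPullbackArrow (f ≫ g) a)
    (fiberPullbackArrow f ((fiberPullback g).obj a) ≫ fiberPullbackArrow g a)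

theorem fiberPullbackComp_inv_arrow {T R S : 𝒮} (f : T ⟶ R) (g : R ⟶ S) (h : T ⟶ S)
    (w : f ≫ g = h) (a : Fiber p S) :
    (fiberPullbackComp f g h w a).inv.1 ≫
      fiberPullbackArrow f ((fiberPullback g).obj a) ≫ fiberPullbackArrow g a =
      fiberPullbackArrow h a := by
  subst w
  exact IsCartesian.fac p (f ≫ g) (fiberPullbackArrow f ((fiberPullback g).obj a) ≫
    fiberPullbackArrow g a) (fiberPullbackArrow (f ≫ g) a)

theorem fiberPullback_hom_ext₂ {T R S : 𝒮} (f : T ⟶ R) (g : R ⟶ S) {a : Fiber p S}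
    {z : Fiber p T} {φ ψ : z ⟶ (fiberPullback f).obj ((fiberPullback g).obj a)}
    (h : φ.1 ≫ fiberPullbackArrow f _ ≫ fiberPullbackArrow g a =
      ψ.1 ≫ fiberPullbackArrow f _ ≫ fiberPullbackArrow g a) : φ = ψ := by
  have h1 := φ.2
  have h2 := ψ.2
  exact Subtype.ext (IsCartesian.ext p (f ≫ g)
    (fiberPullbackArrow f ((fiberPullback g).obj a) ≫ fiberPullbackArrow g a) _ _ h)

/-- The pullback of `φ : b^* y ⟶ a^* x` along `t`, as a morphism `(b ∘ t)^* y ⟶ (a ∘ t)^* x`. -/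
noncomputable def fiberPullbackHom {T V R S : 𝒮} (t : T ⟶ V) {a : V ⟶ R} {b : V ⟶ S} (a' : T ⟶ R)
    (b' : T ⟶ S) (wa : t ≫ a = a') (wb : t ≫ b = b') {x : Fiber p R} {y : Fiber p S}
    (φ : (fiberPullback b).obj y ⟶ (fiberPullback a).obj x) :
    (fiberPullback b').obj y ⟶ (fiberPullback a').obj x :=
  (fiberPullbackComp t b b' wb y).inv ≫ (fiberPullback t).map φ ≫
    (fiberPullbackComp t a a' wa x).hom

theorem fiberPullbackHom_arrow {T V R S : 𝒮} (t : T ⟶ V) {a : V ⟶ R} {b : V ⟶ S} (a' : T ⟶ R)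
    (b' : T ⟶ S) (wa : t ≫ a = a') (wb : t ≫ b = b') {x : Fiber p R} {y : Fiber p S}
    (φ : (fiberPullback b).obj y ⟶ (fiberPullback a).obj x) :
    (fiberPullbackHom t a' b' wa wb φ).1 ≫ fiberPullbackArrow a' x =
      (fiberPullbackComp t b b' wb y).inv.1 ≫ fiberPullbackArrow t _ ≫ φ.1 ≫
        fiberPullbackArrow a x := by
  have h1 := fiberPullbackComp_hom_arrow t a a' wa x
  have h2 := fiberPullback_map_arrow t φ
  change ((fiberPullbackComp t b b' wb y).inv.1 ≫ ((fiberPullback t).map φ).1 ≫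
    (fiberPullbackComp t a a' wa x).hom.1) ≫ _ = _
  rw [Category.assoc, Category.assoc, h1, ← Category.assoc _ _ (fiberPullbackArrow a x), h2,
    Category.assoc]

end Descent

/-- A covering of `U` for the open cover topology: a jointly surjective family of open
immersions. -/
structure OpenCovering (U : CGTop.{u}) : Type (u + 1) where
  ι : Type u
  obj : ι → CGTop.{u}
  map : ∀ i, C(obj i, U)
  isOpenEmbedding : ∀ i, Topology.IsOpenEmbedding (map i)
  jointly_surjective : ∀ x : U, ∃ i y, map i y = x

namespace OpenCovering

variable {U : CGTop.{u}} (c : OpenCovering U)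

/-- The map `σ_i : U_i ⟶ U` as a morphism of the category of spaces. -/
def σ (i : c.ι) : c.obj i ⟶ U := c.map i

/-- The overlap `U_i ×_U U_j`. -/
def overlap (i j : c.ι) : CGTop.{u} := CGTop.of (FibProd (c.map i) (c.map j))

/-- The first projection of `U_i ×_U U_j`. -/
def pr₁ (i j : c.ι) : c.overlap i j ⟶ c.obj i :=
  (⟨fun x => x.fst, FibProd.continuous_fst⟩ : C(FibProd (c.map i) (c.map j), c.obj i))

/-- The second projection of `U_i ×_U U_j`. -/
def pr₂ (i j : c.ι) : c.overlap i j ⟶ c.obj j :=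
  (⟨fun x => x.snd, FibProd.continuous_snd⟩ : C(FibProd (c.map i) (c.map j), c.obj j))

theorem pr_σ (i j : c.ι) : c.pr₂ i j ≫ c.σ j = c.pr₁ i j ≫ c.σ i :=
  ContinuousMap.ext fun x : FibProd (c.map i) (c.map j) => x.w.symm

/-- The triple overlap `U_i ×_U U_j ×_U U_k`, as `U_i ×_U (U_j ×_U U_k)`. -/
def triple (i j k : c.ι) : CGTop.{u} :=
  CGTop.of (FibProd (c.map i) (((c.map j).comp (c.pr₁ j k)) : C(c.overlap j k, U)))

/-- The projection of the triple overlap to `U_j ×_U U_k`. -/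
def pr₂₃ (i j k : c.ι) : c.triple i j k ⟶ c.overlap j k :=
  (⟨fun x => x.snd, FibProd.continuous_snd⟩ :
    C(FibProd (c.map i) (((c.map j).comp (c.pr₁ j k)) : C(c.overlap j k, U)), c.overlap j k))

/-- The projection of the triple overlap to `U_i ×_U U_j`. -/
def pr₁₂ (i j k : c.ι) : c.triple i j k ⟶ c.overlap i j :=
  (⟨fun x => ⟨x.fst, x.snd.fst, x.w⟩, FibProd.continuous_mk FibProd.continuous_fst
      (FibProd.continuous_fst.comp FibProd.continuous_snd) _⟩ :
    C(FibProd (c.map i) (((c.map j).comp (c.pr₁ j k)) : C(c.overlap j k, U)),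
      FibProd (c.map i) (c.map j)))

/-- The projection of the triple overlap to `U_i ×_U U_k`. -/
def pr₁₃ (i j k : c.ι) : c.triple i j k ⟶ c.overlap i k :=
  (⟨fun x => ⟨x.fst, x.snd.snd, x.w.trans x.snd.w⟩, FibProd.continuous_mk FibProd.continuous_fst
      (FibProd.continuous_snd.comp FibProd.continuous_snd) _⟩ :
    C(FibProd (c.map i) (((c.map j).comp (c.pr₁ j k)) : C(c.overlap j k, U)),
      FibProd (c.map i) (c.map k)))

variable (𝒳 : BasedCategory.{u, u + 1} CGTop.{u}) [𝒳.p.IsFibered]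

/-- Descent data for a fibred category relative to a covering. -/
structure DescentDatum : Type (u + 1) where
  obj : ∀ i, Functor.Fiber 𝒳.p (c.obj i)
  iso : ∀ i j, (fiberPullback (c.pr₂ i j)).obj (obj j) ≅ (fiberPullback (c.pr₁ i j)).obj (obj i)
  /-- `pr₁₃^* φ_{ik} = pr₁₂^* φ_{ij} ∘ pr₂₃^* φ_{jk}`, as morphisms from the pullback of `obj k`
  to the pullback of `obj i` on the triple overlap. -/
  cocycle : ∀ i j k,
    fiberPullbackHom (c.pr₁₃ i j k) (c.pr₁₃ i j k ≫ c.pr₁ i k) (c.pr₁₃ i j k ≫ c.pr₂ i k)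
        rfl rfl (iso i k).hom =
      fiberPullbackHom (c.pr₂₃ i j k) (c.pr₁₂ i j k ≫ c.pr₂ i j) (c.pr₁₃ i j k ≫ c.pr₂ i k)
        rfl rfl (iso j k).hom ≫
      fiberPullbackHom (c.pr₁₂ i j k) (c.pr₁₃ i j k ≫ c.pr₁ i k) (c.pr₁₂ i j k ≫ c.pr₂ i j)
        rfl rfl (iso i j).hom

variable {𝒳}

namespace DescentDatum

variable {c}

/-- Morphisms of descent data. -/
@[ext]
structure Hom (D E : c.DescentDatum 𝒳) : Type u where
  hom : ∀ i, D.obj i ⟶ E.obj i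
  comm : ∀ i j, (D.iso i j).hom ≫ (fiberPullback (c.pr₁ i j)).map (hom i) =
    (fiberPullback (c.pr₂ i j)).map (hom j) ≫ (E.iso i j).hom

instance : Category (c.DescentDatum 𝒳) where
  Hom := Hom
  id D := { hom := fun i => 𝟙 _, comm := fun i j => by simp }
  comp F K :=
    { hom := fun i => F.hom i ≫ K.hom i
      comm := fun i j => by
        rw [Functor.map_comp, Functor.map_comp, ← Category.assoc, F.comm, Category.assoc, K.comm,
          Category.assoc] }
  id_comp F := Hom.ext (funext fun i => Category.id_comp _)
  comp_id F := Hom.ext (funext fun i => Category.comp_id _)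
  assoc F K L := Hom.ext (funext fun i => Category.assoc _ _ _)

end DescentDatum

/-- The canonical isomorphism `pr₂^* σ_j^* x ≅ pr₁^* σ_i^* x`. -/
noncomputable def canonicalIso (x : Functor.Fiber 𝒳.p U) (i j : c.ι) :
    (fiberPullback (c.pr₂ i j)).obj ((fiberPullback (c.σ j)).obj x) ≅
      (fiberPullback (c.pr₁ i j)).obj ((fiberPullback (c.σ i)).obj x) :=
  fiberPullbackComp (c.pr₂ i j) (c.σ j) (c.pr₁ i j ≫ c.σ i) (c.pr_σ i j) x ≪≫
    (fiberPullbackComp (c.pr₁ i j) (c.σ i) (c.pr₁ i j ≫ c.σ i) rfl x).symm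

theorem canonicalIso_arrow (x : Functor.Fiber 𝒳.p U) (i j : c.ι) :
    (c.canonicalIso x i j).hom.1 ≫ fiberPullbackArrow (c.pr₁ i j) _ ≫ fiberPullbackArrow (c.σ i) x =
      fiberPullbackArrow (c.pr₂ i j) _ ≫ fiberPullbackArrow (c.σ j) x := by
  have h1 := fiberPullbackComp_hom_arrow (c.pr₂ i j) (c.σ j) (c.pr₁ i j ≫ c.σ i) (c.pr_σ i j) x
  have h2 := fiberPullbackComp_inv_arrow (c.pr₁ i j) (c.σ i) (c.pr₁ i j ≫ c.σ i) rfl x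
  refine Eq.trans ?_ h1
  rw [← h2]
  exact Category.assoc _ _ _

theorem fiberPullbackHom_canonicalIso (x : Functor.Fiber 𝒳.p U) (i j : c.ι) {T : CGTop.{u}}
    (t : T ⟶ c.overlap i j) (a' : T ⟶ c.obj i) (b' : T ⟶ c.obj j) (wa : t ≫ c.pr₁ i j = a')
    (wb : t ≫ c.pr₂ i j = b') :
    (fiberPullbackHom t a' b' wa wb (c.canonicalIso x i j).hom).1 ≫
      fiberPullbackArrow a' _ ≫ fiberPullbackArrow (c.σ i) x =
      fiberPullbackArrow b' _ ≫ fiberPullbackArrow (c.σ j) x := by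
  have h1 := fiberPullbackHom_arrow t a' b' wa wb (c.canonicalIso x i j).hom
  have h2 := c.canonicalIso_arrow x i j
  have h3 := fiberPullbackComp_inv_arrow t (c.pr₂ i j) b' wb ((fiberPullback (c.σ j)).obj x)
  rw [← Category.assoc, h1, Category.assoc, Category.assoc, Category.assoc, h2, ← h3,
    Category.assoc, Category.assoc]

/-- The functor from the fibre over `U` to descent data relative to a covering of `U`. -/
noncomputable def toDescent (𝒳 : BasedCategory.{u, u + 1} CGTop.{u}) [𝒳.p.IsFibered] :
    Functor.Fiber 𝒳.p U ⥤ c.DescentDatum 𝒳 where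
  obj x :=
    { obj := fun i => (fiberPullback (c.σ i)).obj x
      iso := c.canonicalIso x
      cocycle := fun i j k => by
        refine fiberPullback_hom_ext₂ _ _ ?_
        rw [fiberPullbackHom_canonicalIso]
        have h1 := c.fiberPullbackHom_canonicalIso x j k (c.pr₂₃ i j k)
          (c.pr₁₂ i j k ≫ c.pr₂ i j) (c.pr₁₃ i j k ≫ c.pr₂ i k) rfl rfl
        have h2 := c.fiberPullbackHom_canonicalIso x i j (c.pr₁₂ i j k)
          (c.pr₁₃ i j k ≫ c.pr₁ i k) (c.pr₁₂ i j k ≫ c.pr₂ i j) rfl rfl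
        exact (Eq.trans (Category.assoc _ _ _) (Eq.trans (congrArg _ h2) h1)).symm }
  map {x y} φ :=
    { hom := fun i => (fiberPullback (c.σ i)).map φ
      comm := fun i j => by
        refine fiberPullback_hom_ext₂ _ _ ?_
        have a1 := c.canonicalIso_arrow x i j
        have a2 := c.canonicalIso_arrow y i j
        have b1 := fiberPullback_map_arrow (c.pr₁ i j) ((fiberPullback (c.σ i)).map φ)
        have b2 := fiberPullback_map_arrow (c.σ i) φ
        have b3 := fiberPullback_map_arrow (c.pr₂ i j) ((fiberPullback (c.σ j)).map φ)
        have b4 := fiberPullback_map_arrow (c.σ j) φ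
        change ((c.canonicalIso x i j).hom.1 ≫
            ((fiberPullback (c.pr₁ i j)).map ((fiberPullback (c.σ i)).map φ)).1) ≫ _ =
          (((fiberPullback (c.pr₂ i j)).map ((fiberPullback (c.σ j)).map φ)).1 ≫
            (c.canonicalIso y i j).hom.1) ≫ _
        rw [Category.assoc, Category.assoc, a2, ← Category.assoc _ _ (fiberPullbackArrow (c.σ i) y),
          b1, Category.assoc, b2, ← Category.assoc _ _ (fiberPullbackArrow (c.σ j) y), b3,
          Category.assoc, b4, ← Category.assoc _ _ φ.1, ← Category.assoc _ _ φ.1,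
          ← Category.assoc _ _ φ.1, a1] }
  map_id x := DescentDatum.Hom.ext (funext fun i => (fiberPullback (c.σ i)).map_id x)
  map_comp φ ψ := DescentDatum.Hom.ext (funext fun i => (fiberPullback (c.σ i)).map_comp φ ψ)

end OpenCovering

/-- A category fibered in groupoids over compactly generated spaces is a stack if, for each covering
of each space `U`, the functor from its fibre over `U` to descent data is an equivalence. -/
def IsStack (𝒳 : BasedCategory.{u, u + 1} CGTop.{u}) : Prop :=
  ∃ _ : 𝒳.p.IsFibered, (∀ U, ∀ {a b : Functor.Fiber 𝒳.p U} (f : a ⟶ b), IsIso f) ∧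
    ∀ (U : CGTop.{u}) (c : OpenCovering U), (c.toDescent 𝒳).IsEquivalence

/-- A functor over the base is a morphism of fibred categories if it maps cartesian arrows to
cartesian arrows. -/
def IsFiberedMorphism {𝒳 𝒴 : BasedCategory.{u, u + 1} CGTop.{u}} (F : BasedFunctor 𝒳 𝒴) : Prop :=
  ∀ {R S : CGTop.{u}} (f : R ⟶ S) {a b : 𝒳.obj} (φ : a ⟶ b), 𝒳.p.IsStronglyCartesian f φ →
    𝒴.p.IsStronglyCartesian f (F.map φ)

section FiberProduct

variable {𝒳 𝒴 𝒵 : BasedCategory.{u, u + 1} CGTop.{u}} (f : BasedFunctor 𝒴 𝒳)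
  (g : BasedFunctor 𝒵 𝒳)

/-- Objects `(y, z, α : f y ≅ g z)` of the 2-fibre product, where `y` and `z` lie over the same
space and `α` lies over its identity. -/
structure FiberProductObj : Type (u + 1) where
  base : CGTop.{u}
  fst : 𝒴.obj
  snd : 𝒵.obj
  fst_base : 𝒴.p.obj fst = base
  snd_base : 𝒵.p.obj snd = base
  iso : f.obj fst ≅ g.obj snd
  isHomLift : 𝒳.p.IsHomLift (𝟙 base) iso.hom

variable {f g} in
/-- Morphisms `(u, v)` of the 2-fibre product, where `u` and `v` lie over the same map. -/
@[ext]
structure FiberProductHom (x y : FiberProductObj f g) : Type u where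
  base : x.base ⟶ y.base
  fst : x.fst ⟶ y.fst
  snd : x.snd ⟶ y.snd
  fst_isHomLift : 𝒴.p.IsHomLift base fst
  snd_isHomLift : 𝒵.p.IsHomLift base snd
  comm : f.map fst ≫ y.iso.hom = x.iso.hom ≫ g.map snd

instance : Category (FiberProductObj f g) where
  Hom := FiberProductHom
  id x :=
    { base := 𝟙 _
      fst := 𝟙 _
      snd := 𝟙 _
      fst_isHomLift := IsHomLift.id x.fst_base
      snd_isHomLift := IsHomLift.id x.snd_base
      comm := by simp }
  comp F K :=
    { base := F.base ≫ K.base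
      fst := F.fst ≫ K.fst
      snd := F.snd ≫ K.snd
      fst_isHomLift := by
        have := F.fst_isHomLift
        have := K.fst_isHomLift
        infer_instance
      snd_isHomLift := by
        have := F.snd_isHomLift
        have := K.snd_isHomLift
        infer_instance
      comm := by
        rw [Functor.map_comp, Functor.map_comp, Category.assoc, K.comm, ← Category.assoc, F.comm,
          Category.assoc] }
  id_comp F := FiberProductHom.ext (Category.id_comp _) (Category.id_comp _) (Category.id_comp _)
  comp_id F := FiberProductHom.ext (Category.comp_id _) (Category.comp_id _) (Category.comp_id _)
  assoc F K L := FiberProductHom.ext (Category.assoc _ _ _) (Category.assoc _ _ _)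
    (Category.assoc _ _ _)

/-- The 2-fibre product `𝒴 ×_𝒳 𝒵`. -/
def fiberProduct : BasedCategory.{u, u + 1} CGTop.{u} :=
  BasedCategory.ofFunctor
    { obj := fun x : FiberProductObj f g => x.base
      map := fun F => FiberProductHom.base F }

end FiberProduct

/-! ### Fibrations -/

/-- The homotopy lifting property of `p : E → C` with respect to `A`. -/
def HasHLP {E C : Type u} [TopologicalSpace E] [TopologicalSpace C] (A : Type*)
    [TopologicalSpace A] (p : E → C) : Prop :=
  ∀ (h : C(A × unitInterval, C)) (h₀ : C(A, E)), (∀ a, p (h₀ a) = h (a, 0)) →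
    ∃ k : C(A × unitInterval, E), (∀ a, k (a, 0) = h₀ a) ∧ ∀ x, p (k x) = h x

/-- Hurewicz fibrations: the homotopy lifting property holds for all spaces. -/
def IsHurewiczFibration {E C : Type u} [TopologicalSpace E] [TopologicalSpace C]
    (p : E → C) : Prop :=
  Continuous p ∧ ∀ (A : Type u) [TopologicalSpace A], HasHLP A p

/-- Serre fibrations: the homotopy lifting property holds for all cubes. -/
def IsSerreFibration {E C : Type u} [TopologicalSpace E] [TopologicalSpace C]
    (p : E → C) : Prop :=
  Continuous p ∧ ∀ n : ℕ, HasHLP (Fin n → unitInterval) p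

/-- Locally (on source and target) a Hurewicz fibration. -/
def IsLocallyHurewiczFibration {E C : Type u} [TopologicalSpace E] [TopologicalSpace C]
    (p : C(E, C)) : Prop :=
  ∀ e : E, ∃ (V : Set E) (W : Set C) (h : Set.MapsTo p V W), IsOpen V ∧ IsOpen W ∧ e ∈ V ∧
    IsHurewiczFibration (h.restrict p V W)

/-- Locally (on source and target) a Serre fibration. -/
def IsLocallySerreFibration {E C : Type u} [TopologicalSpace E] [TopologicalSpace C]
    (p : C(E, C)) : Prop :=
  ∀ e : E, ∃ (V : Set E) (W : Set C) (h : Set.MapsTo p V W), IsOpen V ∧ IsOpen W ∧ e ∈ V ∧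
    IsSerreFibration (h.restrict p V W)

/-- The topological groupoid `G` is a presentation of `𝒟`: there is an equivalence `BG ≌ 𝒟` over
the category of spaces. -/
def IsPresentation (G : TopGroupoid.{u}) (𝒟 : BasedCategory.{u, u + 1} CGTop.{u}) : Prop :=
  Nonempty (Bicategory.Equivalence (B G) 𝒟)

/-- Topological stacks: stacks equivalent to `BG` for some topological groupoid `G`. -/
def IsTopologicalStack (𝒟 : BasedCategory.{u, u + 1} CGTop.{u}) : Prop :=
  IsStack 𝒟 ∧ ∃ G : TopGroupoid.{u}, IsPresentation G 𝒟

/-- Hurewicz stacks. -/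
def IsHurewiczStack (𝒟 : BasedCategory.{u, u + 1} CGTop.{u}) : Prop :=
  IsTopologicalStack 𝒟 ∧
    ∃ G : TopGroupoid.{u}, IsPresentation G 𝒟 ∧ IsLocallyHurewiczFibration G.src

/-- Serre stacks. -/
def IsSerreStack (𝒟 : BasedCategory.{u, u + 1} CGTop.{u}) : Prop :=
  IsTopologicalStack 𝒟 ∧
    ∃ G : TopGroupoid.{u}, IsPresentation G 𝒟 ∧ IsLocallySerreFibration G.src

/-- Hurewicz morphisms: for each morphism `q` from a space `U` to the target, the 2-fibre product
with `U` is a Hurewicz stack. -/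
def IsHurewiczMorphism {𝒟 𝒞 : BasedCategory.{u, u + 1} CGTop.{u}} (F : BasedFunctor 𝒟 𝒞) : Prop :=
  ∀ (U : CGTop.{u}) (q : BasedFunctor (spaceStack U) 𝒞), IsFiberedMorphism q →
    IsHurewiczStack (fiberProduct F q)

/-- Serre morphisms: for each morphism `q` from a space `U` to the target, the 2-fibre product
with `U` is a Serre stack. -/
def IsSerreMorphism {𝒟 𝒞 : BasedCategory.{u, u + 1} CGTop.{u}} (F : BasedFunctor 𝒟 𝒞) : Prop :=
  ∀ (U : CGTop.{u}) (q : BasedFunctor (spaceStack U) 𝒞), IsFiberedMorphism q →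
    IsSerreStack (fiberProduct F q)

end TopStk

/-! The reason is that the 2-fibre product is a space. A morphism `q : U → BH` is controlled by the
single bundle `Q = q (id_U)` over `U`: each `q a` maps to `Q`, and this map is cartesian because
every morphism of principal bundles is (`BHom.exists_lift`). A principal `[X ⇉ X]`-bundle over `T`
has one-point fibres, so it is the same thing as a map `f : T → X`, and the `H`-bundle induced from
it carries a canonical section with anchor `φ ∘ f`. A bundle morphism out of a bundle with a section
is freely determined by the image of that section (`BHom.exists_of_section`, `BHom.ext_of_section`).
Hence an object of the 2-fibre product over `T` amounts to a map `f : T → X` and a map `k : T → Q`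
with `φ ∘ f = anchor ∘ k`. The map `T → U` is recovered as `proj ∘ k`. So the 2-fibre product is
represented by `Z = X ×_{H₀} Q` (`representationFiberProduct`).

What remains is formal. A category represented by `Z` has fibres equivalent to the sets of maps `T →
Z`. It is a stack because maps glue along open covers (`Representation.toDescent_isEquivalence`).
The category `B[Z ⇉ Z]` is represented by `Z` too (`representationUnit`), and two categories
represented by the same space are equivalent (`Representation.nonempty_equivalence`). So `[Z ⇉ Z]`
is a presentation. Its source map is the identity, which lifts all homotopies and is therefore both
a Hurewicz and a Serre fibration. -/

namespace TopStk

/-! ### Categories over spaces that are represented by a space. -/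

section Representation

open Functor

theorem hom_ext_of_isHomLift {C D : Type*} [Category C] [Category D] {p : D ⥤ C} {a b : D} {R S : C}
    [p.Faithful] (f : R ⟶ S) {φ ψ : a ⟶ b} (hφ : p.IsHomLift f φ) (hψ : p.IsHomLift f ψ) :
    φ = ψ :=
  p.map_injective ((IsHomLift.fac' p f φ).trans (IsHomLift.fac' p f ψ).symm)

/-- A category over spaces is represented by `Z` if it is, up to the choice of its objects, the
category of spaces over `Z`. -/
structure Representation (𝒳 : BasedCategory.{u, u + 1} CGTop.{u}) (Z : CGTop.{u}) where
  toBase : ∀ a : 𝒳.obj, 𝒳.p.obj a ⟶ Z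
  map_toBase : ∀ {a b : 𝒳.obj} (f : a ⟶ b), 𝒳.p.map f ≫ toBase b = toBase a
  faithful : 𝒳.p.Faithful
  full : ∀ {a b : 𝒳.obj} (g : 𝒳.p.obj a ⟶ 𝒳.p.obj b), g ≫ toBase b = toBase a →
    ∃ f : a ⟶ b, 𝒳.p.map f = g
  exists_obj : ∀ {T : CGTop.{u}} (s : T ⟶ Z), ∃ (a : 𝒳.obj) (e : 𝒳.p.obj a = T),
    toBase a = eqToHom e ≫ s

namespace Representation

variable {𝒳 𝒴 : BasedCategory.{u, u + 1} CGTop.{u}} {Z : CGTop.{u}}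

/-- As in the slice over `Z`, an arrow is nothing but a base map compatible with the structure maps.
Fullness produces the required factorisation and faithfulness makes it unique. -/
theorem isStronglyCartesian (R : Representation 𝒳 Z) {a b : 𝒳.obj} {S T : CGTop.{u}} (f : S ⟶ T) (φ : a ⟶ b)
    [h : 𝒳.p.IsHomLift f φ] : 𝒳.p.IsStronglyCartesian f φ where
  universal_property' {a'} g φ' hφ' := by
    have := R.faithful
    cases h
    have e : g ≫ 𝒳.p.map φ = 𝒳.p.map φ' := IsHomLift.eq_of_isHomLift 𝒳.p _ φ'
    obtain ⟨χ, rfl⟩ := R.full g (by rw [← R.map_toBase φ, ← R.map_toBase φ', ← e, Category.assoc])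
    refine ⟨χ, ⟨inferInstance, 𝒳.p.map_injective (by rw [Functor.map_comp, e])⟩, fun ψ hψ => ?_⟩
    have := hψ.1
    exact 𝒳.p.map_injective (IsHomLift.eq_of_isHomLift 𝒳.p _ ψ).symm

/-- The pullback of `a` along `f` is any object whose structure map is `f ≫ toBase a`; the arrow to
`a` comes from fullness and is automatically cartesian. -/
theorem isFibered (R : Representation 𝒳 Z) : 𝒳.p.IsFibered :=
  IsFibered.of_exists_isStronglyCartesian fun a S f => by
    obtain ⟨b, e, hb⟩ := R.exists_obj (f ≫ R.toBase a)
    subst e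
    obtain ⟨φ, rfl⟩ := R.full (a := b) (b := a) f (by rw [hb, eqToHom_refl, Category.id_comp])
    exact ⟨b, φ, R.isStronglyCartesian _ _⟩

/-- The structure map of an object over `T`. -/
def fiberToBase (R : Representation 𝒳 Z) {T : CGTop.{u}} (a : Fiber 𝒳.p T) : T ⟶ Z := eqToHom a.2.symm ≫ R.toBase a.1

theorem comp_fiberToBase (R : Representation 𝒳 Z) {S T : CGTop.{u}} (a : Fiber 𝒳.p S) (b : Fiber 𝒳.p T) (f : S ⟶ T)
    (φ : a.1 ⟶ b.1) [h : 𝒳.p.IsHomLift f φ] : f ≫ R.fiberToBase b = R.fiberToBase a := by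
  obtain ⟨a, rfl⟩ := a
  obtain ⟨b, rfl⟩ := b
  rw [IsHomLift.eq_of_isHomLift 𝒳.p f φ]
  simp [fiberToBase, R.map_toBase]

/-- With `nonempty_fiber_hom` and `fiberToBase_eq`, this identifies the fibre over `T` with the set
of maps `T ⟶ Z`. Every later compatibility between arrows of a fibre then holds for free. -/
theorem fiber_hom_subsingleton (R : Representation 𝒳 Z) {T : CGTop.{u}} (a b : Fiber 𝒳.p T) : Subsingleton (a ⟶ b) where
  allEq f g := have := R.faithful; Subtype.ext (hom_ext_of_isHomLift (𝟙 T) f.2 g.2)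

theorem nonempty_fiber_hom (R : Representation 𝒳 Z) {T : CGTop.{u}} {a b : Fiber 𝒳.p T}
    (h : R.fiberToBase a = R.fiberToBase b) : Nonempty (a ⟶ b) := by
  obtain ⟨a, ha⟩ := a
  obtain ⟨b, rfl⟩ := b
  obtain ⟨φ, hφ⟩ := R.full (a := a) (b := b) (eqToHom ha) (by
    have : 𝟙 _ ≫ R.toBase b = eqToHom ha.symm ≫ R.toBase a := h.symm
    rw [Category.id_comp] at this
    rw [this, eqToHom_trans_assoc, eqToHom_refl, Category.id_comp])
  exact ⟨⟨φ, IsHomLift.of_fac' 𝒳.p _ _ ha rfl (by rw [hφ]; simp)⟩⟩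

theorem fiberToBase_eq (R : Representation 𝒳 Z) {T : CGTop.{u}} {a b : Fiber 𝒳.p T} (f : a ⟶ b) :
    R.fiberToBase a = R.fiberToBase b := by
  have := f.2
  rw [← R.comp_fiberToBase a b (𝟙 T) f.1, Category.id_comp]

theorem fiber_isIso (R : Representation 𝒳 Z) {T : CGTop.{u}} {a b : Fiber 𝒳.p T} (f : a ⟶ b) : IsIso f := by
  obtain ⟨g⟩ := R.nonempty_fiber_hom (R.fiberToBase_eq f).symm
  exact ⟨g, (R.fiber_hom_subsingleton _ _).elim _ _, (R.fiber_hom_subsingleton _ _).elim _ _⟩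

theorem exists_fiber (R : Representation 𝒳 Z) {T : CGTop.{u}} (s : T ⟶ Z) : ∃ a : Fiber 𝒳.p T, R.fiberToBase a = s := by
  obtain ⟨a, e, h⟩ := R.exists_obj s
  refine ⟨⟨a, e⟩, ?_⟩
  simp [fiberToBase, h]

theorem fiberToBase_pullback (R : Representation 𝒳 Z) [𝒳.p.IsFibered] {S T : CGTop.{u}} (f : S ⟶ T) (a : Fiber 𝒳.p T) :
    R.fiberToBase ((fiberPullback f).obj a) = f ≫ R.fiberToBase a :=
  (R.comp_fiberToBase _ a f (fiberPullbackArrow f a)).symm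

end Representation

/-! ### Descent for represented categories. -/

/-- Maps on the members of an open covering that agree on the overlaps glue. -/
theorem OpenCovering.exists_glue {U Z : CGTop.{u}} (c : OpenCovering U)
    (t : ∀ i, C(c.obj i, Z)) (h : ∀ i j (x : c.obj i) (y : c.obj j), c.map i x = c.map j y →
      t i x = t j y) : ∃ s : C(U, Z), ∀ i x, s (c.map i x) = t i x := by
  choose ι y hy using c.jointly_surjective
  -- Agreement on overlaps makes the glued value independent of the index and preimage chosen for
  -- the point.
  have key : ∀ i x, t (ι (c.map i x)) (y (c.map i x)) = t i x := fun i x => h _ _ _ _ (hy _)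
  refine ⟨⟨fun x => t (ι x) (y x), continuous_iff_continuousAt.2 fun x => ?_⟩, key⟩
  -- Continuity at a point in the image of an open embedding can be tested after composing with it,
  -- where the glued map becomes `t (ι x)`.
  rw [← hy x, (c.isOpenEmbedding (ι x)).continuousAt_iff.symm]
  exact ((t (ι x)).continuous.congr fun z => (key _ z).symm).continuousAt

namespace Representation

variable {𝒳 𝒴 : BasedCategory.{u, u + 1} CGTop.{u}} {Z : CGTop.{u}}

theorem descent_hom_subsingleton (R : Representation 𝒳 Z) [𝒳.p.IsFibered] {U : CGTop.{u}} (c : OpenCovering U)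
    (D E : c.DescentDatum 𝒳) : Subsingleton (D ⟶ E) where
  allEq _ _ := OpenCovering.DescentDatum.Hom.ext
    (funext fun i => (R.fiber_hom_subsingleton (D.obj i) (E.obj i)).elim _ _)

theorem nonempty_descent_hom (R : Representation 𝒳 Z) [𝒳.p.IsFibered] {U : CGTop.{u}} (c : OpenCovering U)
    {D E : c.DescentDatum 𝒳} (h : ∀ i, R.fiberToBase (D.obj i) = R.fiberToBase (E.obj i)) :
    Nonempty (D ⟶ E) :=
  ⟨⟨fun i => (R.nonempty_fiber_hom (h i)).some,
    fun _ _ => (R.fiber_hom_subsingleton _ _).elim _ _⟩⟩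

/-- This is the sheaf property of maps into `Z`. Fullness says that two maps agreeing on a cover are
equal, and essential surjectivity says that compatible local maps glue. The remaining conditions are
equalities of arrows between objects of one fibre. -/
theorem toDescent_isEquivalence (R : Representation 𝒳 Z) [𝒳.p.IsFibered] {U : CGTop.{u}} (c : OpenCovering U) :
    (c.toDescent 𝒳).IsEquivalence where
  faithful := ⟨fun {a b _ _} _ => (R.fiber_hom_subsingleton a b).elim _ _⟩
  full := ⟨fun {a b} F => by
    have h : R.fiberToBase a = R.fiberToBase b := by
      refine ContinuousMap.ext fun x => ?_
      obtain ⟨i, y, rfl⟩ := c.jointly_surjective x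
      have e := R.fiberToBase_eq (F.hom i)
      have ha := R.fiberToBase_pullback (c.σ i) a
      have hb := R.fiberToBase_pullback (c.σ i) b
      exact congrArg (fun f : C(c.obj i, Z) => f y) (ha.symm.trans (e.trans hb))
    obtain ⟨f⟩ := R.nonempty_fiber_hom h
    exact ⟨f, (R.descent_hom_subsingleton c _ _).elim _ _⟩⟩
  essSurj := ⟨fun D => by
    obtain ⟨s, hs⟩ := c.exists_glue (fun i => (R.fiberToBase (D.obj i) : C(c.obj i, Z)))
      fun i j x y h => by
        -- The transition isomorphism lies in the fibre over the overlap, so the two structure maps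
        -- pulled back to the overlap are equal; evaluating at the point `(x, y)` gives the
        -- agreement needed for gluing.
        have e := R.fiberToBase_eq (D.iso i j).hom
        rw [R.fiberToBase_pullback, R.fiberToBase_pullback] at e
        exact (congrArg (fun f : C(c.overlap i j, Z) =>
          f (⟨x, y, h⟩ : FibProd (c.map i) (c.map j))) e).symm
    obtain ⟨a, ha⟩ := R.exists_fiber (T := U) s
    have h : ∀ i, R.fiberToBase (((c.toDescent 𝒳).obj a).obj i) = R.fiberToBase (D.obj i) :=
      fun i => (R.fiberToBase_pullback (c.σ i) a).trans (by
        rw [ha]; exact ContinuousMap.ext (hs i))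
    obtain ⟨f⟩ := R.nonempty_descent_hom c h
    obtain ⟨g⟩ := R.nonempty_descent_hom c fun i => (h i).symm
    exact ⟨a, ⟨⟨f, g, (R.descent_hom_subsingleton c _ _).elim _ _,
      (R.descent_hom_subsingleton c _ _).elim _ _⟩⟩⟩⟩

theorem isStack (R : Representation 𝒳 Z) : IsStack 𝒳 := by
  have := R.isFibered
  exact ⟨this, fun _ _ _ f => R.fiber_isIso f, fun _ c => R.toDescent_isEquivalence c⟩

/-- Each object is sent to some object of `𝒴` with the same structure map. A based functor must
commute with the projections strictly, which is why `exists_obj` asks for an object lying over `T`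
itself and not merely over an isomorphic space. Functoriality follows from faithfulness. -/
theorem exists_functor (R : Representation 𝒳 Z) (S : Representation 𝒴 Z) : ∃ F : BasedFunctor 𝒳 𝒴,
    ∀ a, S.toBase (F.obj a) = eqToHom (F.w_obj a) ≫ R.toBase a := by
  have := S.faithful
  choose o e h using fun a : 𝒳.obj => S.exists_obj (R.toBase a)
  have hf : ∀ {a b : 𝒳.obj} (f : a ⟶ b), ∃ g : o a ⟶ o b,
      𝒴.p.map g = eqToHom (e a) ≫ 𝒳.p.map f ≫ eqToHom (e b).symm := fun {a b} f =>
    S.full _ (by simp [h, R.map_toBase])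
  choose m hm using @hf
  exact ⟨{
    obj := o
    map := m
    map_id := fun a => 𝒴.p.map_injective (by simp [hm])
    map_comp := fun f g => 𝒴.p.map_injective (by simp [hm])
    w := CategoryTheory.Functor.ext e fun a b f => hm f }, h⟩

/-- Both functors preserve structure maps, so the identity of each base lifts to an arrow `F a ⟶ G
a`. Invertibility and naturality may be checked on bases. -/
theorem nonempty_iso (R : Representation 𝒳 Z) (S : Representation 𝒴 Z) (F G : BasedFunctor 𝒳 𝒴)
    (hF : ∀ a, S.toBase (F.obj a) = eqToHom (F.w_obj a) ≫ R.toBase a)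
    (hG : ∀ a, S.toBase (G.obj a) = eqToHom (G.w_obj a) ≫ R.toBase a) : Nonempty (F ≅ G) := by
  have := S.faithful
  have hp : ∀ (F : BasedFunctor 𝒳 𝒴) {a b} (f : a ⟶ b), 𝒴.p.map (F.map f) =
      eqToHom (F.w_obj a) ≫ 𝒳.p.map f ≫ eqToHom (F.w_obj b).symm :=
    fun F _ _ f => Functor.congr_hom F.w f
  -- The two functors are quantified again so that the same construction, with the roles exchanged,
  -- yields the inverse components.
  have key : ∀ F G : BasedFunctor 𝒳 𝒴,
      (∀ a, S.toBase (F.obj a) = eqToHom (F.w_obj a) ≫ R.toBase a) →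
      (∀ a, S.toBase (G.obj a) = eqToHom (G.w_obj a) ≫ R.toBase a) → ∀ a,
      ∃ f : F.obj a ⟶ G.obj a, 𝒴.p.map f =
        eqToHom ((F.w_obj a).trans (G.w_obj a).symm) := fun F G hF hG a => by
    exact S.full _ (by rw [hF, hG, eqToHom_trans_assoc])
  choose α hα using key F G hF hG
  choose β hβ using key G F hG hF
  refine ⟨BasedNatIso.mkNatIso (NatIso.ofComponents (fun a => ⟨α a, β a,
    𝒴.p.map_injective ?_, 𝒴.p.map_injective ?_⟩) fun {a b} f => 𝒴.p.map_injective ?_) fun a => ?_⟩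
  · simp [hα, hβ]
  · simp [hα, hβ]
  · simp [hα, hp]
  · exact IsHomLift.of_fac' 𝒴.p _ _ (F.w_obj a) (G.w_obj a) (by
      change 𝒴.p.map (α a) = _
      simp [hα])

/-- Categories represented by the same space are equivalent. -/
theorem nonempty_equivalence (R : Representation 𝒳 Z) (S : Representation 𝒴 Z) :
    Nonempty (Bicategory.Equivalence 𝒳 𝒴) := by
  obtain ⟨F, hF⟩ := R.exists_functor S
  obtain ⟨G, hG⟩ := S.exists_functor R
  obtain ⟨η⟩ := R.nonempty_iso R (BasedFunctor.id 𝒳) (F.comp G)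
    (fun a => (Category.id_comp _).symm) fun a => (hG _).trans (by rw [hF, eqToHom_trans_assoc]; rfl)
  obtain ⟨ε⟩ := S.nonempty_iso S (G.comp F) (BasedFunctor.id 𝒴)
    (fun a => (hF _).trans (by rw [hG, eqToHom_trans_assoc]; rfl)) fun a => (Category.id_comp _).symm
  -- The triangle identities need no verification: the counit is replaced by one that satisfies
  -- them.
  exact ⟨Bicategory.Equivalence.mkOfAdjointifyCounit (f := F) (g := G) η ε⟩

end Representation

end Representation

/-! ### Morphisms of principal bundles. -/

namespace BHom

variable {G : TopGroupoid.{u}} {P P' Q : BObj G}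

theorem proj_surjective (P : BObj G) : Function.Surjective P.bundle.proj := fun m => by
  obtain ⟨U, _, hm, σ, hσ⟩ := P.bundle.principal.localSections m
  exact ⟨σ ⟨m, hm⟩, hσ ⟨m, hm⟩⟩

theorem ext_onTotal {F K : BHom P Q} (h : ∀ p, F.onTotal p = K.onTotal p) : F = K := by
  refine BHom.ext (ContinuousMap.ext fun m => ?_) (ContinuousMap.ext h)
  obtain ⟨p, rfl⟩ := proj_surjective P m
  rw [← F.proj_onTotal, ← K.proj_onTotal, h]

/-- Write `p' = p · γ`. Equivariance turns `L p = L p'` into `L p · 1 = L p · γ`, and the action on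
`Q` is free, so `γ` is an identity arrow. -/
theorem onTotal_injOn_fiber (L : BHom P Q) {p p' : P.bundle.total}
    (h : P.bundle.proj p = P.bundle.proj p') (hL : L.onTotal p = L.onTotal p') : p = p' := by
  have e := P.bundle.principal.act_div ⟨p, p', h⟩
  have w := P.bundle.principal.anchor_eq ⟨p, p', h⟩
  have hone : P.bundle.principal.div ⟨p, p', h⟩ = G.one (P.bundle.action.anchor p) := by
    refine Q.bundle.principal.free (p := L.onTotal p) (w := (L.anchor_onTotal p).trans w)
      (w' := (L.anchor_onTotal p).trans (G.tgt_one _).symm) ?_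
    rw [← L.map_act p _ w, e, ← hL, ← L.map_act p _ (G.tgt_one _).symm, P.bundle.action.act_one]
  dsimp only at e w
  rw [← e]
  exact ((P.bundle.action.act_congr (w' := (G.tgt_one _).symm) rfl hone).trans
    (P.bundle.action.act_one p _)).symm

/-- This is the uniqueness half of cartesianness; `exists_lift` is the existence half. -/
theorem hom_ext_of_onBase (L : BHom P' Q) {F K : BHom P P'} (h : F.onBase = K.onBase)
    (hL : ∀ p, L.onTotal (F.onTotal p) = L.onTotal (K.onTotal p)) : F = K :=
  ext_onTotal fun p => L.onTotal_injOn_fiber (by rw [F.proj_onTotal, K.proj_onTotal, h]) (hL p)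

/-- Morphisms of principal bundles are cartesian. -/
theorem exists_lift (K : BHom P Q) (L : BHom P' Q) (g : C(P.base, P'.base))
    (h : ∀ m, L.onBase (g m) = K.onBase m) :
    ∃ F : BHom P P', F.onBase = g ∧ ∀ p, L.onTotal (F.onTotal p) = K.onTotal p := by
  have hw : ∀ (p : P.bundle.total) (p' : P'.bundle.total),
      P'.bundle.proj p' = g (P.bundle.proj p) →
      Q.bundle.proj (L.onTotal p') = Q.bundle.proj (K.onTotal p) := fun p p' e => by
    rw [L.proj_onTotal, K.proj_onTotal, e, h]
  have ha : ∀ (p : P.bundle.total) (p' : P'.bundle.total)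
      (e : P'.bundle.proj p' = g (P.bundle.proj p)), P'.bundle.action.anchor p' =
        G.tgt (Q.bundle.principal.div ⟨L.onTotal p', K.onTotal p, hw p p' e⟩) := fun p p' e =>
    (L.anchor_onTotal p').symm.trans (Q.bundle.principal.anchor_eq ⟨_, _, hw p p' e⟩)
  -- Any `p'` over `g (π p)` can be moved within its fibre by the arrow carrying `L p'` to `K p`,
  -- after which its image under `L` is exactly `K p`. By `onTotal_injOn_fiber` the resulting point
  -- is unique, so it is the only possible value of `F p`.
  have hL : ∀ (p : P.bundle.total) (p' : P'.bundle.total)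
      (e : P'.bundle.proj p' = g (P.bundle.proj p)),
      L.onTotal (P'.bundle.action.act ⟨p', _, ha p p' e⟩) = K.onTotal p := fun p p' e =>
    (L.map_act p' _ _ (Q.bundle.principal.anchor_eq ⟨_, _, hw p p' e⟩)).trans
      (Q.bundle.principal.act_div ⟨_, _, hw p p' e⟩)
  have hex : ∀ p : P.bundle.total, ∃ p' : P'.bundle.total,
      P'.bundle.proj p' = g (P.bundle.proj p) ∧ L.onTotal p' = K.onTotal p := fun p => by
    obtain ⟨p', e⟩ := proj_surjective P' (g (P.bundle.proj p))
    exact ⟨_, (P'.bundle.principal.proj_act' _ _ _).trans e, hL p p' e⟩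
  choose F hF₁ hF₂ using hex
  have hF : Continuous F := by
    -- Pointwise choices carry no continuity. Locally, the same correction applied to a continuous
    -- section `σ` of `P'` is continuous, and uniqueness in the fibre identifies it with `F`.
    refine continuous_of_local P.bundle.proj.continuous fun m => ?_
    obtain ⟨U, hU, hm, σ, hσ⟩ := P'.bundle.principal.localSections (g m)
    refine ⟨g ⁻¹' U, hU.preimage g.continuous, hm, ?_⟩
    have := compactlyGeneratedSpace_of_isOpen_subset
      ((hU.preimage g.continuous).preimage P.bundle.proj.continuous)
    have c : Continuous fun z : P.bundle.proj ⁻¹' (g ⁻¹' U) => σ ⟨g (P.bundle.proj z), z.2⟩ :=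
      σ.continuous.comp (((g.continuous.comp P.bundle.proj.continuous).comp
        continuous_subtype_val).subtype_mk _)
    have key : Continuous fun z : P.bundle.proj ⁻¹' (g ⁻¹' U) =>
        P'.bundle.action.act ⟨σ ⟨g (P.bundle.proj z), z.2⟩, _, ha z _ (hσ _)⟩ :=
      P'.bundle.action.act.continuous.comp (FibProd.continuous_mk c
        (Q.bundle.principal.div.continuous.comp (FibProd.continuous_mk (L.onTotal.continuous.comp c)
          (K.onTotal.continuous.comp continuous_subtype_val) _)) _)
    convert key using 2 with z
    refine L.onTotal_injOn_fiber ?_ ((hF₂ z).trans (hL _ _ (hσ ⟨_, z.2⟩)).symm)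
    rw [hF₁, P'.bundle.principal.proj_act', hσ]
  have hanchor : ∀ p, P'.bundle.action.anchor (F p) = P.bundle.action.anchor p := fun p => by
    rw [← L.anchor_onTotal, hF₂, K.anchor_onTotal]
  refine ⟨⟨g, ⟨F, hF⟩, hanchor, fun p γ w w' => L.onTotal_injOn_fiber ?_ ?_, hF₁⟩, rfl, hF₂⟩
  · change P'.bundle.proj (F _) = _
    rw [hF₁, P'.bundle.principal.proj_act', P.bundle.principal.proj_act']
    exact (hF₁ p).symm
  · have w'' := (K.anchor_onTotal p).trans w
    refine (hF₂ _).trans ((K.map_act p γ w w'').trans ?_)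
    refine Eq.trans ?_ (L.map_act (F p) γ w' ((L.anchor_onTotal _).trans w')).symm
    exact Q.bundle.action.act_congr (hF₂ p).symm rfl

/-- Every `p` is a translate of `s (π p)`, so an equivariant map is determined by its values on the
section. -/
theorem ext_of_section (s : P.base → P.bundle.total) (hs : ∀ m, P.bundle.proj (s m) = m)
    {F K : BHom P Q} (h : ∀ m, F.onTotal (s m) = K.onTotal (s m)) : F = K := by
  refine ext_onTotal fun p => ?_
  have e := P.bundle.principal.act_div ⟨s (P.bundle.proj p), p, hs _⟩
  have w := P.bundle.principal.anchor_eq ⟨s (P.bundle.proj p), p, hs _⟩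
  dsimp only at e w
  rw [← e]
  refine (F.map_act _ _ w ((F.anchor_onTotal _).trans w)).trans (Eq.trans ?_
    (K.map_act _ _ w ((K.anchor_onTotal _).trans w)).symm)
  exact Q.bundle.action.act_congr (h _) rfl

/-- A morphism out of a trivialised principal bundle is given by the image of the section. -/
theorem exists_of_section (s : C(P.base, P.bundle.total)) (hs : ∀ m, P.bundle.proj (s m) = m)
    (k : C(P.base, Q.bundle.total))
    (h : ∀ m, Q.bundle.action.anchor (k m) = P.bundle.action.anchor (s m)) :
    ∃ F : BHom P Q, ∀ m, F.onTotal (s m) = k m := by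
  let y : P.bundle.total → FibProd P.bundle.proj P.bundle.proj :=
    fun p => ⟨s (P.bundle.proj p), p, hs _⟩
  have hy : Continuous y := FibProd.continuous_mk
    (s.continuous.comp P.bundle.proj.continuous) continuous_id _
  have w : ∀ p, P.bundle.action.anchor (s (P.bundle.proj p)) = G.tgt (P.bundle.principal.div (y p)) :=
    fun p => P.bundle.principal.anchor_eq (y p)
  have wk : ∀ p, Q.bundle.action.anchor (k (P.bundle.proj p)) =
      G.tgt (P.bundle.principal.div (y p)) := fun p => (h _).trans (w p)
  have hact : ∀ p, P.bundle.action.act ⟨s (P.bundle.proj p), P.bundle.principal.div (y p), w p⟩ = p :=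
    fun p => P.bundle.principal.act_div (y p)
  -- Since `p = s (π p) · div (y p)`, equivariance forces `p` to go to `k (π p) · div (y p)`, and
  -- the base map is then forced to be `proj ∘ k`.
  refine ⟨⟨Q.bundle.proj.comp k, ⟨fun p => Q.bundle.action.act
    ⟨k (P.bundle.proj p), P.bundle.principal.div (y p), wk p⟩, ?_⟩, fun p => ?_,
    fun p γ v v' => ?_, fun p => Q.bundle.principal.proj_act' _ _ _⟩, fun m => ?_⟩
  · exact Q.bundle.action.act.continuous.comp (FibProd.continuous_mk
      (k.continuous.comp P.bundle.proj.continuous)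
      (P.bundle.principal.div.continuous.comp hy) _)
  · exact (Q.bundle.action.anchor_act _).trans (P.bundle.principal.src_div (y p))
  · have hγ : G.src (P.bundle.principal.div (y p)) = G.tgt γ :=
      (P.bundle.principal.src_div (y p)).trans v
    have hproj := P.bundle.principal.proj_act' p γ v
    -- Both arrows carry `s (π p)` to `p · γ`, so they coincide by freeness.
    have e : P.bundle.principal.div (y (P.bundle.action.act ⟨p, γ, v⟩)) =
        G.comp ⟨P.bundle.principal.div (y p), γ, hγ⟩ := by
      refine P.bundle.principal.free (w := w _)
        (w' := (congrArg (fun m => P.bundle.action.anchor (s m)) hproj).trans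
          ((w p).trans (G.tgt_comp ⟨_, γ, hγ⟩).symm)) ((hact _).trans ?_)
      refine Eq.trans ?_ ((P.bundle.action.act_act (s (P.bundle.proj p)) _ γ (w p)
        ((P.bundle.action.anchor_act _).trans hγ) hγ ((w p).trans (G.tgt_comp ⟨_, γ, hγ⟩).symm)).trans
        (P.bundle.action.act_congr (congrArg s hproj.symm) rfl))
      exact P.bundle.action.act_congr (hact p).symm rfl
    refine Eq.trans ?_ (Q.bundle.action.act_act (k (P.bundle.proj p)) _ γ (wk p) v' hγ
      ((wk p).trans (G.tgt_comp ⟨_, γ, hγ⟩).symm)).symm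
    exact Q.bundle.action.act_congr (congrArg k hproj) e
  · have hm : s (P.bundle.proj (s m)) = s m := congrArg s (hs m)
    -- At a point of the section the translating arrow is an identity, so the formula returns `k m`
    -- there.
    have e : P.bundle.principal.div (y (s m)) = G.one (P.bundle.action.anchor (s m)) := by
      refine P.bundle.principal.free (w := w _)
        (w' := (congrArg P.bundle.action.anchor hm).trans (G.tgt_one _).symm)
        ((hact _).trans ?_)
      exact ((P.bundle.action.act_congr hm rfl).trans
        (P.bundle.action.act_one (s m) (G.tgt_one _).symm)).symm
    have ek : k (P.bundle.proj (s m)) = k m := congrArg k (hs m)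
    exact (Q.bundle.action.act_congr ek (e.trans (congrArg G.one (h m).symm))).trans
      (Q.bundle.action.act_one (k m) (G.tgt_one _).symm)

/-- A morphism of principal bundles over an invertible map is invertible. -/
theorem exists_inverse (F : BHom P Q) (g : C(Q.base, P.base)) (h : ∀ m, F.onBase (g m) = m)
    (h' : ∀ m, g (F.onBase m) = m) :
    ∃ K : BHom Q P, (∀ p, K.onTotal (F.onTotal p) = p) ∧ ∀ p, F.onTotal (K.onTotal p) = p := by
  -- Lifting the identity of `Q` through the cartesian morphism `F` gives a right inverse;
  -- injectivity of `F` on fibres makes it a left inverse as well.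
  obtain ⟨K, rfl, hK⟩ := exists_lift (𝟙 Q : Q ⟶ Q) F g h
  refine ⟨K, fun p => F.onTotal_injOn_fiber ?_ (hK _), hK⟩
  rw [K.proj_onTotal, F.proj_onTotal, h']

end BHom

/-! ### Principal bundles for the groupoid `[Z ⇉ Z]`. -/

namespace BObj

variable {Z : CGTop.{u}}

/-- Two points of a fibre differ by an arrow of `[Z ⇉ Z]`, and all such arrows are identities. -/
theorem unit_proj_injective (P : BObj (TopGroupoid.unit Z)) :
    Function.Injective P.bundle.proj := fun p p' h => by
  have w := P.bundle.principal.anchor_eq ⟨p, p', h⟩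
  refine Eq.trans ?_ (P.bundle.principal.act_div ⟨p, p', h⟩)
  exact ((P.bundle.action.act_congr (w' := rfl) rfl w.symm).trans
    (P.bundle.action.act_one p rfl)).symm

theorem exists_unit_section (P : BObj (TopGroupoid.unit Z)) :
    ∃ s : C(P.base, P.bundle.total), ∀ m, P.bundle.proj (s m) = m := by
  choose s hs using BHom.proj_surjective P
  refine ⟨⟨s, continuous_of_local continuous_id fun m => ?_⟩, hs⟩
  obtain ⟨U, hU, hm, σ, hσ⟩ := P.bundle.principal.localSections m
  -- As the projection is injective, the pointwise choice `s` has to agree with the local section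
  -- `σ`, which makes it continuous.
  exact ⟨U, hU, hm, σ.continuous.congr fun z =>
    P.unit_proj_injective ((hσ z).trans (hs _).symm)⟩

/-- The section of a principal bundle for a groupoid with only identity arrows. -/
noncomputable def unitSection (P : BObj (TopGroupoid.unit Z)) : C(P.base, P.bundle.total) :=
  P.exists_unit_section.choose

theorem proj_unitSection (P : BObj (TopGroupoid.unit Z)) (m : P.base) :
    P.bundle.proj (P.unitSection m) = m := P.exists_unit_section.choose_spec m

theorem onTotal_unitSection {P P' : BObj (TopGroupoid.unit Z)} (F : BHom P P') (m : P.base) :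
    F.onTotal (P.unitSection m) = P'.unitSection (F.onBase m) :=
  P'.unit_proj_injective (by rw [F.proj_onTotal, proj_unitSection, proj_unitSection])

/-- The classifying map of a principal bundle for a groupoid with only identity arrows. -/
noncomputable def unitMap (P : BObj (TopGroupoid.unit Z)) : C(P.base, Z) :=
  P.bundle.action.anchor.comp P.unitSection

theorem unitMap_onBase {P P' : BObj (TopGroupoid.unit Z)} (F : BHom P P') (m : P.base) :
    P'.unitMap (F.onBase m) = P.unitMap m :=
  (congrArg P'.bundle.action.anchor (onTotal_unitSection F m).symm).trans (F.anchor_onTotal _)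

/-- The morphism takes the section of `P` at `m` to the section of `P'` at `g m`; the hypothesis on
classifying maps is precisely the matching of anchors that this requires. -/
theorem exists_unit_hom {P P' : BObj (TopGroupoid.unit Z)} (g : C(P.base, P'.base))
    (h : ∀ m, P'.unitMap (g m) = P.unitMap m) : ∃ F : BHom P P', F.onBase = g := by
  have ha : ∀ m, P'.bundle.action.anchor ((P'.unitSection.comp g) m) =
      P.bundle.action.anchor (P.unitSection m) := h
  obtain ⟨F, hF⟩ := BHom.exists_of_section P.unitSection P.proj_unitSection
    (P'.unitSection.comp g) ha
  refine ⟨F, ContinuousMap.ext fun m => ?_⟩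
  have := congrArg P'.bundle.proj (hF m)
  rw [F.proj_onTotal, proj_unitSection] at this
  exact this.trans (P'.proj_unitSection _)

theorem exists_unitMap_eq {T : CGTop.{u}} (s : C(T, Z)) : ∃ (P : BObj (TopGroupoid.unit Z))
    (e : P.base = T), (P.unitMap : P.base ⟶ Z) = eqToHom e ≫ s := by
  refine ⟨⟨T, (PrincipalBundle.unit (TopGroupoid.unit Z)).pullback s⟩, rfl, ?_⟩
  rw [eqToHom_refl, Category.id_comp]
  let P : BObj (TopGroupoid.unit Z) := ⟨T, (PrincipalBundle.unit (TopGroupoid.unit Z)).pullback s⟩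
  refine ContinuousMap.ext fun m : T => ?_
  let x : FibProd s (PrincipalBundle.unit (TopGroupoid.unit Z)).proj := P.unitSection m
  have hx : x.fst = m := P.proj_unitSection m
  -- The anchor of the pulled-back unit bundle is the second component of the point, and the fibre
  -- product condition equates it with `s` of the first, which is `m`.
  exact x.w.symm.trans (congrArg s hx)

end BObj

/-- The stack of principal bundles of `[Z ⇉ Z]` is represented by `Z`. -/
noncomputable def representationUnit (Z : CGTop.{u}) :
    Representation (B (TopGroupoid.unit Z)) Z where
  toBase P := BObj.unitMap P
  map_toBase F := ContinuousMap.ext fun m => BObj.unitMap_onBase F m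
  faithful := ⟨fun {P P'} F K h => BHom.ext_onTotal (P := P) fun p =>
    BObj.unit_proj_injective P' ((F.proj_onTotal p).trans
      ((congrArg (fun f : C(P.base, P'.base) => f (P.bundle.proj p)) h).trans
        (K.proj_onTotal p).symm))⟩
  full {P P'} g h := BObj.exists_unit_hom (P := P) (P' := P') g fun m =>
    congrArg (fun f : C(P.base, Z) => f m) h
  exists_obj s := BObj.exists_unitMap_eq s

/-! ### From objects of the 2-fibre product to maps into `X ×_{H₀} Q`. -/

section FiberProduct

variable {X : CGTop.{u}} {H : TopGroupoid.{u}} (φ : (TopGroupoid.unit X).Hom H)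

/-- The canonical section of the principal `H`-bundle associated with a principal
`[X ⇉ X]`-bundle. -/
noncomputable def tensorSection (P : BObj (TopGroupoid.unit X)) :
    C(P.base, Bibundle.Tensor P.bundle (Bibundle.ofHom φ)) where
  -- The identity arrow at `φ (unitMap m)` is the canonical section of `t : H₁ → H₀`, pulled back
  -- along `φ ∘ unitMap`.
  toFun m := Bibundle.Tensor.mk ⟨P.unitSection m,
    ⟨P.unitMap m, H.one (φ.onObj (P.unitMap m)), (H.tgt_one _).symm⟩, rfl⟩
  continuous_toFun := Bibundle.Tensor.continuous_mk.comp (FibProd.continuous_mk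
    P.unitSection.continuous (FibProd.continuous_mk P.unitMap.continuous
      (H.one.continuous.comp (φ.onObj.continuous.comp P.unitMap.continuous)) _) _)

/-- The principal `H`-bundle associated with a principal `[X ⇉ X]`-bundle. -/
noncomputable abbrev inducedObj (P : BObj (TopGroupoid.unit X)) : BObj H := (B.map φ).obj P

/-- The morphism of principal `H`-bundles associated with a morphism of principal
`[X ⇉ X]`-bundles. -/
noncomputable abbrev inducedHom {P P' : BObj (TopGroupoid.unit X)} (F : P ⟶ P') :
    BHom (inducedObj φ P) (inducedObj φ P') := (B.map φ).map F

theorem proj_tensorSection (P : BObj (TopGroupoid.unit X)) (m : P.base) :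
    (inducedObj φ P).bundle.proj (tensorSection φ P m) = m := P.proj_unitSection m

theorem anchor_tensorSection (P : BObj (TopGroupoid.unit X)) (m : P.base) :
    (inducedObj φ P).bundle.action.anchor (tensorSection φ P m) = φ.onObj (P.unitMap m) :=
  H.src_one _

theorem inducedHom_tensorSection {P P' : BObj (TopGroupoid.unit X)} (F : BHom P P') (m : P.base) :
    (inducedHom φ F).onTotal (tensorSection φ P m) = tensorSection φ P' (F.onBase m) := by
  refine Bibundle.Tensor.mk_congr (BObj.onTotal_unitSection F m) ?_
  have e := BObj.unitMap_onBase F m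
  exact FibProd.hom_ext e.symm (congrArg (fun x => H.one (φ.onObj x)) e.symm)

variable {U : CGTop.{u}} (q : BasedFunctor (spaceStack U) (B H))

/-- The principal `H`-bundle over `U` classified by a morphism from `U` to `BH`. -/
def classifiedBundle : BObj H := q.obj (Over.mk (𝟙 U))

/-- The tautological morphism to the bundle classified by `q`. -/
noncomputable def toClassified (a : Over U) : (q.obj a : BObj H) ⟶ classifiedBundle q :=
  q.map (Over.mkIdTerminal.from a)

theorem map_toClassified {a b : Over U} (f : a ⟶ b) :
    (q.map f : (q.obj a : BObj H) ⟶ (q.obj b : BObj H)) ≫ toClassified q b = toClassified q a :=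
  (q.map_comp f (Over.mkIdTerminal.from b)).symm.trans
    (congrArg q.map (Over.mkIdTerminal.hom_ext _ _))

/-- The functor `r` stands for `q` followed by the projection of `BH`, which equals `Over.forget U`
only propositionally. Keeping it a variable lets the equality be eliminated, so that no transport
appears. The same holds for `over_exists_obj`. -/
theorem over_exists_hom {C : Type*} [Category C] {U : C} {r : Over U ⥤ C} (hr : r = Over.forget U)
    {a b : Over U} (g : r.obj a ⟶ r.obj b) (h : g ≫ r.map (Over.mkIdTerminal.from b) =
      r.map (Over.mkIdTerminal.from a)) : ∃ f : a ⟶ b, r.map f = g := by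
  subst hr
  have e : ∀ a : Over U, (Over.mkIdTerminal.from a).left = a.hom := fun a =>
    (Category.comp_id _).symm.trans (Over.w (Over.mkIdTerminal.from a))
  refine ⟨Over.homMk g ?_, rfl⟩
  rw [← e, ← e]
  exact h

theorem over_exists_obj {C : Type*} [Category C] {U : C} {r : Over U ⥤ C} (hr : r = Over.forget U)
    {T : C} (f : T ⟶ r.obj (Over.mk (𝟙 U))) : ∃ (a : Over U) (e : r.obj a = T),
      r.map (Over.mkIdTerminal.from a) = eqToHom e ≫ f := by
  subst hr
  refine ⟨Over.mk f, rfl, ?_⟩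
  have e : ∀ a : Over U, (Over.mkIdTerminal.from a).left = a.hom := fun a =>
    (Category.comp_id _).symm.trans (Over.w (Over.mkIdTerminal.from a))
  exact (e _).trans (Category.id_comp _).symm

/-- The space `X ×_{H₀} Q` that represents the 2-fibre product, where `Q` is the principal bundle
classified by `q`. -/
noncomputable def fiberProductSpace : CGTop.{u} :=
  CGTop.of (FibProd φ.onObj (classifiedBundle q).bundle.action.anchor)

namespace FiberProductObj

variable {φ q} (x : FiberProductObj (B.map φ) q)

/-- The principal `[X ⇉ X]`-bundle of an object of the 2-fibre product. -/
def bundle : BObj (TopGroupoid.unit X) := x.fst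

/-- The morphism from the induced bundle of an object of the 2-fibre product to the bundle
classified by `q`. -/
noncomputable def toClassified : inducedObj φ x.bundle ⟶ classifiedBundle q :=
  x.iso.hom ≫ TopStk.toClassified q x.snd

/-- The map to the space that represents the 2-fibre product. -/
noncomputable def toSpace : C(x.bundle.base, fiberProductSpace φ q) where
  toFun m := (⟨x.bundle.unitMap m, BHom.onTotal x.toClassified (tensorSection φ x.bundle m),
    ((BHom.anchor_onTotal x.toClassified _).trans (anchor_tensorSection φ x.bundle m)).symm⟩ :
      FibProd φ.onObj (classifiedBundle q).bundle.action.anchor)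
  continuous_toFun := FibProd.continuous_mk x.bundle.unitMap.continuous
    ((BHom.onTotal x.toClassified).continuous.comp (tensorSection φ x.bundle).continuous) _

/-- The compatibility square of `F` is composed with the terminal cocone `q b ⟶ Q`, which absorbs
the component of `F` in `Over U`. -/
theorem comp_toClassified {x y : FiberProductObj (B.map φ) q} (F : x ⟶ y) :
    (inducedHom φ F.fst : inducedObj φ x.bundle ⟶ inducedObj φ y.bundle) ≫ y.toClassified =
      x.toClassified := by
  have h : (inducedHom φ F.fst : inducedObj φ x.bundle ⟶ inducedObj φ y.bundle) ≫ y.iso.hom =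
      x.iso.hom ≫ q.map F.snd := F.comm
  refine (Category.assoc _ _ _).symm.trans ((congrArg (· ≫ _) h).trans ?_)
  refine (Category.assoc _ _ _).trans ?_
  exact congrArg (x.iso.hom ≫ ·) (map_toClassified q F.snd)

theorem toSpace_onBase {x y : FiberProductObj (B.map φ) q} (F : x ⟶ y) (m : x.bundle.base) :
    y.toSpace (BHom.onBase F.fst m) = x.toSpace m := by
  refine FibProd.hom_ext (BObj.unitMap_onBase F.fst m) ?_
  refine (congrArg (BHom.onTotal y.toClassified) (inducedHom_tensorSection φ F.fst m).symm).trans ?_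
  exact congrArg (fun K : BHom _ _ => K.onTotal (tensorSection φ x.bundle m)) (comp_toClassified F)

end FiberProductObj

end FiberProduct

/-! ### Transport along equalities of base spaces. -/

section HomLift

variable {C D : Type*} [Category C] [Category D] {p : D ⥤ C} {a b : D} {R S Z : C}

/-- Components of an object of the 2-fibre product lie over its base only up to a propositional
equality. This passes between triangles over the named bases and triangles over the actual
projections. -/
theorem comp_eqToHom_comp_iff (ha : p.obj a = R) (hb : p.obj b = S) (f : R ⟶ S) (φ : a ⟶ b)
    [p.IsHomLift f φ] (s : p.obj a ⟶ Z) (t : p.obj b ⟶ Z) :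
    f ≫ eqToHom hb.symm ≫ t = eqToHom ha.symm ≫ s ↔ p.map φ ≫ t = s := by
  subst ha hb
  rw [IsHomLift.eq_of_isHomLift p f φ]
  simp

theorem eqToHom_conj_comp {A B : C} (ha : A = R) (hb : B = S) {f : R ⟶ S} {s : A ⟶ Z} {t : B ⟶ Z}
    (h : f ≫ eqToHom hb.symm ≫ t = eqToHom ha.symm ≫ s) :
    (eqToHom ha ≫ f ≫ eqToHom hb.symm) ≫ t = s := by
  subst ha hb
  simpa using h

theorem eqToHom_comp_eqToHom_symm {A B : C} (h : A = B) : eqToHom h ≫ eqToHom h.symm = 𝟙 A :=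
  (eqToHom_trans _ _).trans (eqToHom_refl _ _)

end HomLift

/-! ### Representability of the 2-fibre product by `X ×_{H₀} Q`. -/

section FiberProductRepresentation

variable {X : CGTop.{u}} {H : TopGroupoid.{u}} {φ : (TopGroupoid.unit X).Hom H}
  {U : CGTop.{u}} {q : BasedFunctor (spaceStack U) (B H)}

namespace FiberProductObj

/-- The map to the representing space, on the base of an object of the 2-fibre product. -/
noncomputable def baseToSpace (x : FiberProductObj (B.map φ) q) :
    x.base ⟶ fiberProductSpace φ q :=
  eqToHom x.fst_base.symm ≫ (x.toSpace : x.bundle.base ⟶ fiberProductSpace φ q)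

theorem base_comp_baseToSpace {x y : FiberProductObj (B.map φ) q} (F : x ⟶ y) :
    F.base ≫ y.baseToSpace = x.baseToSpace := by
  have := F.fst_isHomLift
  exact (comp_eqToHom_comp_iff x.fst_base y.fst_base F.base F.fst
    (x.toSpace : x.bundle.base ⟶ fiberProductSpace φ q)
    (y.toSpace : y.bundle.base ⟶ fiberProductSpace φ q)).2 (ContinuousMap.ext (toSpace_onBase F))

theorem hom_ext_base {x y : FiberProductObj (B.map φ) q} {F K : x ⟶ y} (h : F.base = K.base) :
    F = K := by
  have := (representationUnit X).faithful
  have : (spaceStack U).p.Faithful := inferInstanceAs (Over.forget U).Faithful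
  exact FiberProductHom.ext h
    (hom_ext_of_isHomLift F.base F.fst_isHomLift (h ▸ K.fst_isHomLift))
    (hom_ext_of_isHomLift F.base F.snd_isHomLift (h ▸ K.snd_isHomLift))

/-- The `X`-coordinate of the hypothesis provides the morphism of `[X ⇉ X]`-bundles. The
`Q`-coordinate says that the induced morphism of `H`-bundles is compatible with the maps to `Q`, and
this yields the component in `Over U`. -/
theorem exists_hom {x y : FiberProductObj (B.map φ) q} (g : x.base ⟶ y.base)
    (h : g ≫ y.baseToSpace = x.baseToSpace) : ∃ F : x ⟶ y, F.base = g := by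
  let g₀ : C(x.bundle.base, y.bundle.base) :=
    (eqToHom x.fst_base ≫ g ≫ eqToHom y.fst_base.symm : x.bundle.base ⟶ y.bundle.base)
  have hg₀ : ∀ m, y.toSpace (g₀ m) = x.toSpace m := fun m =>
    congrArg (fun f : C(x.bundle.base, fiberProductSpace φ q) => f m)
      (eqToHom_conj_comp (s := (x.toSpace : x.bundle.base ⟶ fiberProductSpace φ q))
        (t := (y.toSpace : y.bundle.base ⟶ fiberProductSpace φ q)) x.fst_base y.fst_base h)
  obtain ⟨f, hf⟩ := BObj.exists_unit_hom (P := x.bundle) (P' := y.bundle) g₀ fun m =>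
    congrArg FibProd.fst (hg₀ m)
  let F : inducedObj φ x.bundle ⟶ inducedObj φ y.bundle := inducedHom φ f
  have hF : F ≫ y.toClassified = x.toClassified := by
    -- Both sides are morphisms out of a bundle with a section, so it suffices to compare them
    -- there, where they are the `Q`-coordinates of `toSpace`.
    refine BHom.ext_of_section (tensorSection φ x.bundle) (proj_tensorSection φ x.bundle) fun m => ?_
    refine (congrArg (BHom.onTotal y.toClassified) (inducedHom_tensorSection φ f m)).trans ?_
    rw [hf]
    exact congrArg FibProd.snd (hg₀ m)
  -- The compatibility square leaves no other choice for the image under `q` of the component in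
  -- `Over U`.
  let K : q.obj x.snd ⟶ q.obj y.snd := x.iso.inv ≫ F ≫ y.iso.hom
  have hK : K ≫ q.map (Over.mkIdTerminal.from y.snd) = q.map (Over.mkIdTerminal.from x.snd) := by
    refine (Category.assoc _ _ _).trans ((Iso.inv_comp_eq x.iso).2 ?_)
    exact (Category.assoc _ _ _).trans hF
  obtain ⟨k, hk⟩ := over_exists_hom (r := q.toFunctor.comp (B H).p) q.w (a := x.snd) (b := y.snd)
    ((B H).p.map K) (((B H).p.map_comp _ _).symm.trans (congrArg (B H).p.map hK))
  -- So far `k` and `K` agree only on bases. They also agree after composition with the map to `Q`,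
  -- and that map is cartesian.
  have hkK : q.map k = K := by
    have e : (q.map k ≫ TopStk.toClassified q y.snd : q.obj x.snd ⟶ classifiedBundle q) =
      K ≫ q.map (Over.mkIdTerminal.from y.snd) := (map_toClassified q k).trans hK.symm
    exact BHom.hom_ext_of_onBase (TopStk.toClassified q y.snd) hk fun p =>
      congrArg (fun f : BHom (q.obj x.snd) (classifiedBundle q) => f.onTotal p) e
  have hfg : (B (TopGroupoid.unit X)).p.IsHomLift g (show x.fst ⟶ y.fst from f) :=
    IsHomLift.of_fac' _ _ _ x.fst_base y.fst_base hf
  have hkg : (spaceStack U).p.IsHomLift g k := by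
    refine (q.isHomLift_iff g k).1 ?_
    rw [hkK]
    have := x.isHomLift
    have := y.isHomLift
    have : (B H).p.IsHomLift g ((B.map φ).map (show x.fst ⟶ y.fst from f)) := inferInstance
    have : (B H).p.IsHomLift (𝟙 x.base ≫ g ≫ 𝟙 y.base)
      (x.iso.inv ≫ (B.map φ).map (show x.fst ⟶ y.fst from f) ≫ y.iso.hom) := inferInstance
    rwa [Category.id_comp, Category.comp_id] at this
  exact ⟨⟨g, f, k, hfg, hkg, by
    rw [hkK]
    exact ((Iso.hom_inv_id_assoc x.iso _)).symm⟩, rfl⟩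

/-- The `X`-coordinate of `s` is the classifying map of a bundle `P`, and the `Q`-coordinate is the
image of the section under a morphism `L` from the induced bundle to `Q`. The base map of `L` gives
the object `a` of `Over U`, and factoring `L` through `q a ⟶ Q` gives the isomorphism. -/
theorem exists_baseToSpace_eq {T : CGTop.{u}} (s : T ⟶ fiberProductSpace φ q) :
    ∃ (x : FiberProductObj (B.map φ) q) (e : x.base = T), x.baseToSpace = eqToHom e ≫ s := by
  let s' : C(T, FibProd φ.onObj (classifiedBundle q).bundle.action.anchor) := s
  obtain ⟨P, rfl, hP⟩ := BObj.exists_unitMap_eq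
    (⟨fun m => (s' m).fst, FibProd.continuous_fst.comp s'.continuous⟩ : C(T, X))
  have hP' : ∀ m, P.unitMap m = (s' m).fst := fun m => by
    rw [eqToHom_refl, Category.id_comp] at hP
    exact congrArg (fun f : C(P.base, X) => f m) hP
  obtain ⟨L, hL⟩ := BHom.exists_of_section (P := inducedObj φ P) (Q := classifiedBundle q)
    (tensorSection φ P) (proj_tensorSection φ P)
    ⟨fun m => (s' m).snd, FibProd.continuous_snd.comp s'.continuous⟩ fun m =>
      (s' m).w.symm.trans ((congrArg φ.onObj (hP' m).symm).trans (anchor_tensorSection φ P m).symm)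
  obtain ⟨a, e, ha⟩ := over_exists_obj (r := q.toFunctor.comp (B H).p) q.w (T := P.base) L.onBase
  -- The bundle `q a` lies over `P.base` only up to the equality `e`, so the comparison `α` covers
  -- this transport map; since it is invertible, so is `α`.
  let g : P.base ⟶ (q.obj a : BObj H).base := eqToHom e.symm
  have hg : g ≫ (TopStk.toClassified q a).onBase = (L.onBase : P.base ⟶ (classifiedBundle q).base) := by
    refine (congrArg (g ≫ ·) ha).trans ((Category.assoc _ _ _).symm.trans ?_)
    exact (congrArg (· ≫ _) (eqToHom_comp_eqToHom_symm e.symm)).trans (Category.id_comp _)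
  obtain ⟨α, hα, hαL⟩ := BHom.exists_lift L (TopStk.toClassified q a) g fun m =>
    congrArg (fun f : C(P.base, (classifiedBundle q).base) => f m) hg
  have h₁ : (eqToHom e : (q.obj a : BObj H).base ⟶ P.base) ≫ g = 𝟙 _ :=
    eqToHom_comp_eqToHom_symm e
  have h₂ : g ≫ (eqToHom e : (q.obj a : BObj H).base ⟶ P.base) = 𝟙 _ :=
    eqToHom_comp_eqToHom_symm e.symm
  obtain ⟨β, hβ₁, hβ₂⟩ := α.exists_inverse
    (eqToHom e : (q.obj a : BObj H).base ⟶ P.base)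
    (fun m => by rw [hα]; exact congrArg (fun f : C(_, _) => f m) h₁)
    (fun m => by rw [hα]; exact congrArg (fun f : C(_, _) => f m) h₂)
  refine ⟨⟨P.base, P, a, rfl, (q.w_obj a).symm.trans e,
    ⟨α, β, BHom.ext_onTotal hβ₁, BHom.ext_onTotal hβ₂⟩,
    IsHomLift.of_fac' _ _ _ rfl e (hα.trans (Category.id_comp _).symm)⟩, rfl, ?_⟩
  rw [baseToSpace]
  refine congrArg (eqToHom _ ≫ ·) (ContinuousMap.ext fun m => FibProd.hom_ext (hP' m) ?_)
  exact (hαL _).trans (hL m)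

end FiberProductObj

/-- The 2-fibre product of a space with the morphism induced by `[X ⇉ X] → H` is represented by
`X ×_{H₀} Q`. -/
noncomputable def representationFiberProduct :
    Representation (fiberProduct (B.map φ) q) (fiberProductSpace φ q) where
  toBase x := FiberProductObj.baseToSpace x
  map_toBase F := FiberProductObj.base_comp_baseToSpace F
  faithful := ⟨fun h => FiberProductObj.hom_ext_base h⟩
  full g h := FiberProductObj.exists_hom g h
  exists_obj s := FiberProductObj.exists_baseToSpace_eq s

end FiberProductRepresentation

/-! ### The identity as a fibration, and the conclusion for represented categories. -/

/-- A homotopy in the base is its own lift. The identity is restricted to the whole space because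
local fibrations are defined through restrictions to open subsets. -/
theorem hasHLP_univ {E : Type u} [TopologicalSpace E] (A : Type*) [TopologicalSpace A]
    (h : Set.MapsTo (ContinuousMap.id E) Set.univ Set.univ) :
    HasHLP A (h.restrict (ContinuousMap.id E) Set.univ Set.univ) :=
  fun f _ h₀ => ⟨f, fun a => (h₀ a).symm, fun _ => rfl⟩

theorem isLocallyHurewiczFibration_id (E : Type u) [TopologicalSpace E] :
    IsLocallyHurewiczFibration (ContinuousMap.id E) := fun _ =>
  ⟨Set.univ, Set.univ, Set.mapsTo_univ _ _, isOpen_univ, isOpen_univ, trivial,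
    continuous_id.restrict _, fun A _ => hasHLP_univ A _⟩

theorem isLocallySerreFibration_id (E : Type u) [TopologicalSpace E] :
    IsLocallySerreFibration (ContinuousMap.id E) := fun _ =>
  ⟨Set.univ, Set.univ, Set.mapsTo_univ _ _, isOpen_univ, isOpen_univ, trivial,
    continuous_id.restrict _, fun _ => hasHLP_univ _ _⟩

namespace Representation

variable {𝒳 : BasedCategory.{u, u + 1} CGTop.{u}} {Z : CGTop.{u}}

theorem isPresentation_unit (R : Representation 𝒳 Z) : IsPresentation (TopGroupoid.unit Z) 𝒳 :=
  (representationUnit Z).nonempty_equivalence R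

theorem isTopologicalStack (R : Representation 𝒳 Z) : IsTopologicalStack 𝒳 :=
  ⟨R.isStack, _, R.isPresentation_unit⟩

/-- The presentation is `[Z ⇉ Z]`, whose source map is by definition the identity of `Z`. -/
theorem isHurewiczStack (R : Representation 𝒳 Z) : IsHurewiczStack 𝒳 :=
  ⟨R.isTopologicalStack, _, R.isPresentation_unit, isLocallyHurewiczFibration_id _⟩

theorem isSerreStack (R : Representation 𝒳 Z) : IsSerreStack 𝒳 :=
  ⟨R.isTopologicalStack, _, R.isPresentation_unit, isLocallySerreFibration_id _⟩

end Representation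

end TopStk

/-- For a compactly generated Hausdorff space `X`, a topological groupoid `H` and a morphism of
topological groupoids `φ : [X ⇉ X] → H`, the induced morphism of stacks `B[X ⇉ X] → BH` is both a
Serre morphism and a Hurewicz morphism. -/
theorem mainTheorem5 (X : TopStk.CGTop.{u}) (H : TopStk.TopGroupoid.{u})
    (φ : TopStk.TopGroupoid.Hom (TopStk.TopGroupoid.unit X) H) :
    TopStk.IsSerreMorphism (TopStk.B.map φ) ∧ TopStk.IsHurewiczMorphism (TopStk.B.map φ) :=
  ⟨fun _ _ _ => TopStk.representationFiberProduct.isSerreStack,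
    fun _ _ _ => TopStk.representationFiberProduct.isHurewiczStack⟩
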